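/- For $a\in\mathbb{R}^n$ and $t\in\mathbb{R}$, the halfspace with weights $a$ and threshold $t$ is the Boolean function $f\colon\{-1,1\}^n\to\{0,1\}$, $f(x)=\mathbb{1}\left(\sum_i a_i x_i>t\right)$. Let $\mathbb{E}[f]$ be its expectation with respect to the uniform measure on $\{-1,1\}^n$, let $\mathbb{1}_f=\{x: f(x)=1\}$, and let $\partial(\mathbb{1}_f)$ be the (inner) vertex boundary of $\mathbb{1}_f$ in the discrete cube graph, that is, the set of all $x\in\mathbb{1}_f$ such that flipping some single coordinate of $x$ gives a point outside $\mathbb{1}_f$. **Theorem.** There exist universal constants $c'_1,c'_2>0$ such that for every $n\ge 1$ and every halfspace $f=\mathbb{1}\left(\sum_i a_i x_i>t\right)$ on $\{-1,1\}^n$ with $\mathbb{E}[f]\le\frac12$, $a_1\ge a_2\ge\dots\ge a_n\ge 0$ and $\sum_i a_i^2=1$, $$c'_1\,\mathbb{E}[f]\min\left\{1,a_1\sqrt{\log(1/\mathbb{E}[f])}\right\}\le\frac{|\partial(\mathbb{1}_f)|}{2^n}\le c'_2\,\mathbb{E}[f]\min\left\{1,a_1\sqrt{\log(1/\mathbb{E}[f])}\right\},$$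 where $\log$ is the natural logarithm. (If $\mathbb{E}[f]=0$, the two outer expressions are read as $0$.) -/

import Mathlib

open Finset

noncomputable section

namespace BiasedHalfspace

/-- The discrete cube `{-1,1}^n`; the units of `ℤ` are exactly `1` and `-1`. -/
abbrev Cube (n : ℕ) : Type := Fin n → ℤˣ

/-- The point `x ⊕ e_i`, obtained from `x` by flipping its `i`-th coordinate. The neighbours of `x`
in the discrete cube graph are exactly the points `flipCoord x i`. -/
def flipCoord {n : ℕ} (x : Cube n) (i : Fin n) : Cube n := Function.update x i (-x i)

/-- The linear form `∑ i, a_i x_i` on the cube. -/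
def linForm {n : ℕ} (a : Fin n → ℝ) (x : Cube n) : ℝ := ∑ i, a i * (((x i : ℤˣ) : ℤ) : ℝ)

open Classical in
/-- The halfspace `f = 𝟙(∑ i, a_i x_i > t)`, a function from the cube to `{0,1}`. -/
def halfspace {n : ℕ} (a : Fin n → ℝ) (t : ℝ) (x : Cube n) : ℝ :=
  if t < linForm a x then 1 else 0

/-- The expectation `E[f]` with respect to the uniform measure on the cube. -/
def expectation {n : ℕ} (f : Cube n → ℝ) : ℝ := (∑ x, f x) / 2 ^ n

open Classical in
/-- The set `𝟙_f = {x : f x = 1}` of a Boolean function `f`. -/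
def oneSet {n : ℕ} (f : Cube n → ℝ) : Finset (Cube n) := {x | f x = 1}

open Classical in
/-- The (inner) vertex boundary `∂S` of a set `S` of vertices of the discrete cube: the vertices
in `S` that have a neighbour outside `S`. -/
def vertexBoundary {n : ℕ} (S : Finset (Cube n)) : Finset (Cube n) :=
  {x ∈ S | ∃ i : Fin n, flipCoord x i ∉ S}

end BiasedHalfspace

end

/-!
Write `S = ∑ i, a i * x i`, `ε = P(S > t)` and `L = log (1 / ε)`; `a₁ = a 0` is the largest weight.
Replacing `t` by `max t 0` does not change a halfspace of measure at most `1/2`, so let `t ≥ 0`.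

The boundary contains `{x₁ = 1, t < S ≤ t + 2 a₁}` (flip the first coordinate) and is contained in
`{t < S ≤ t + 2 a₁}`. Both events have probability of order `ε min(1, a₁ √L)`, and three tools show
this.

* Reflection. Flipping coordinates one after the other until their partial sum passes a level `h`
  moves `S` down by an amount in `[2h, 2h + 2m]`, where `m` is the largest weight, and is injective.
  So an interval above the origin is at most as likely as a slightly longer one further down
  (`prob_interval_le_reflect`). Conditioning on the two largest weights absorbs the loss in length:
  no interval `(u, u + 2 a₁]` with `u ≥ t` is much likelier than `{x₁ = 1, t < S ≤ t + 2 a₁}`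
  (`prob_interval_le_influence`).

* Local Chernoff inequality. For noise of rate `ρ ≈ 1/L`, a point with `S > t + C/√L` stays in the
  halfspace with probability close to `1`, by Chebyshev's inequality and Hoeffding's bound
  `t = O(√L)`. Small-set expansion says that only a bounded fraction of the halfspace can do so.
  Hence `P(S > t + C/√L) ≤ 3ε/4` (`prob_add_shift_le`). Covering `(t, t + C/√L]` by intervals of
  length `2 a₁` and comparing each with `{x₁ = 1, t < S ≤ t + 2 a₁}` gives the lower bound.

* Reverse local Chernoff inequality. If `a₁ √L` is small, noise of rate `ρ ≈ c/L` carries each point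
  with `S > t - s`, `s = c'/√L`, above `t` with probability bounded below, by a fourth moment
  argument. Noise preserves the uniform measure, so `P(S > t - s) ≤ 33 ε` (`prob_sub_shift_le`).
  If `t ≥ s`, reflection finds about `s / a₁` disjoint intervals inside `(t - s, t]` each at least as
  likely as `(t, t + 2 a₁]`, which is the upper bound. If `t < s`, then `ε` is bounded below and
  `P(t < S ≤ t + 2 a₁) = O(a₁)` by a Littlewood–Offord bound (`exists_prob_interval_le`).
-/

namespace BiasedHalfspace

/-! ### Expectations on the cube -/

/-- The expectation of `F z` when the coordinates of `z` are independent and each of them is `-1`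
with probability `ρ`. It is defined as a weighted sum for every real `ρ`. -/
noncomputable def biasedExp (ρ : ℝ) {n : ℕ} (F : Cube n → ℝ) : ℝ :=
  ∑ z, (∏ i, if z i = 1 then 1 - ρ else ρ) * F z

theorem sum_cube_succ {n : ℕ} (F : Cube (n + 1) → ℝ) :
    ∑ z, F z = ∑ z : Cube n, F (Fin.cons 1 z) + ∑ z : Cube n, F (Fin.cons (-1) z) := by
  rw [← (Fin.consEquiv fun _ => ℤˣ).sum_comp, Fintype.sum_prod_type]
  have : (univ : Finset ℤˣ) = {1, -1} := by decide
  rw [this, sum_pair (by decide)]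
  rfl

theorem biasedExp_succ (ρ : ℝ) {n : ℕ} (F : Cube (n + 1) → ℝ) :
    biasedExp ρ F = (1 - ρ) * biasedExp ρ (fun z => F (Fin.cons 1 z)) +
      ρ * biasedExp ρ (fun z => F (Fin.cons (-1) z)) := by
  have h : ((-1 : ℤˣ) = 1) = False := by decide
  simp [biasedExp, sum_cube_succ, Fin.prod_univ_succ, mul_sum, mul_assoc, h]

theorem biasedExp_zero (ρ : ℝ) (F : Cube 0 → ℝ) : biasedExp ρ F = F 1 := by
  simp only [biasedExp, univ_eq_empty, prod_empty, one_mul, univ_unique, sum_singleton]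
  congr 1
  exact Subsingleton.elim _ _

theorem biasedExp_add (ρ : ℝ) {n : ℕ} (F G : Cube n → ℝ) :
    biasedExp ρ (fun z => F z + G z) = biasedExp ρ F + biasedExp ρ G := by
  simp [biasedExp, mul_add, sum_add_distrib]

theorem biasedExp_sub (ρ : ℝ) {n : ℕ} (F G : Cube n → ℝ) :
    biasedExp ρ (fun z => F z - G z) = biasedExp ρ F - biasedExp ρ G := by
  simp [biasedExp, mul_sub, sum_sub_distrib]

theorem biasedExp_const_mul (ρ : ℝ) {n : ℕ} (c : ℝ) (F : Cube n → ℝ) :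
    biasedExp ρ (fun z => c * F z) = c * biasedExp ρ F := by
  simp [biasedExp, mul_sum, mul_left_comm]

theorem biasedExp_const (ρ : ℝ) {n : ℕ} (c : ℝ) :
    biasedExp ρ (fun _ : Cube n => c) = c := by
  induction n with
  | zero => rw [biasedExp_zero]
  | succ n ih => rw [biasedExp_succ, ih]; ring

theorem biasedExp_sum (ρ : ℝ) {n : ℕ} {ι : Type*} (s : Finset ι) (F : ι → Cube n → ℝ) :
    biasedExp ρ (fun z => ∑ k ∈ s, F k z) = ∑ k ∈ s, biasedExp ρ (F k) := by
  simp only [biasedExp, mul_sum]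
  exact sum_comm

theorem biasedExp_mono {ρ : ℝ} (h0 : 0 ≤ ρ) (h1 : ρ ≤ 1) {n : ℕ} {F G : Cube n → ℝ}
    (h : ∀ z, F z ≤ G z) : biasedExp ρ F ≤ biasedExp ρ G := by
  refine sum_le_sum fun z _ => mul_le_mul_of_nonneg_left (h z) (prod_nonneg fun i _ => ?_)
  split_ifs <;> linarith

theorem expectation_eq_biasedExp {n : ℕ} (F : Cube n → ℝ) :
    expectation F = biasedExp (1 / 2) F := by
  have : ∀ z : Cube n, (∏ i, if z i = 1 then 1 - (1 / 2 : ℝ) else 1 / 2) = (2 ^ n)⁻¹ := by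
    intro z
    rw [prod_congr rfl (g := fun _ => (2 : ℝ)⁻¹) (by intro i _; split_ifs <;> norm_num)]
    simp
  simp only [expectation, biasedExp, this, ← mul_sum]
  ring

theorem expectation_succ {n : ℕ} (F : Cube (n + 1) → ℝ) :
    expectation F = (expectation (fun z => F (Fin.cons 1 z)) +
      expectation (fun z => F (Fin.cons (-1) z))) / 2 := by
  simp only [expectation_eq_biasedExp, biasedExp_succ]
  ring

theorem expectation_add {n : ℕ} (F G : Cube n → ℝ) :
    expectation (fun z => F z + G z) = expectation F + expectation G := by
  simp only [expectation_eq_biasedExp, biasedExp_add]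

theorem expectation_const_mul {n : ℕ} (c : ℝ) (F : Cube n → ℝ) :
    expectation (fun z => c * F z) = c * expectation F := by
  simp only [expectation_eq_biasedExp, biasedExp_const_mul]

theorem expectation_sum {n : ℕ} {ι : Type*} (s : Finset ι) (F : ι → Cube n → ℝ) :
    expectation (fun z => ∑ k ∈ s, F k z) = ∑ k ∈ s, expectation (F k) := by
  simp only [expectation_eq_biasedExp, biasedExp_sum]

theorem expectation_const {n : ℕ} (c : ℝ) : expectation (fun _ : Cube n => c) = c := by
  rw [expectation_eq_biasedExp, biasedExp_const]

theorem expectation_mono {n : ℕ} {F G : Cube n → ℝ} (h : ∀ z, F z ≤ G z) :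
    expectation F ≤ expectation G := by
  simp only [expectation_eq_biasedExp]
  exact biasedExp_mono (by norm_num) (by norm_num) h

theorem expectation_nonneg {n : ℕ} {F : Cube n → ℝ} (h : ∀ z, 0 ≤ F z) :
    0 ≤ expectation F := by
  simpa [expectation_const] using expectation_mono h

theorem expectation_mul_right {n : ℕ} (F : Cube n → ℝ) (z : Cube n) :
    expectation (fun x => F (x * z)) = expectation F := by
  unfold expectation
  rw [← Equiv.sum_comp (Equiv.mulRight z) F]
  rfl

/-! ### Events and the linear form -/

theorem linForm_cons {n : ℕ} (a : Fin (n + 1) → ℝ) (b : ℤˣ) (x : Cube n) :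
    linForm a (Fin.cons b x) = a 0 * ((b : ℤ) : ℝ) + linForm (fun i => a i.succ) x := by
  simp [linForm, Fin.sum_univ_succ]

open Classical in
/-- The probability of the event `A` under the uniform measure on the cube. -/
noncomputable def prob {n : ℕ} (A : Cube n → Prop) : ℝ :=
  expectation (fun x => if A x then 1 else 0)

theorem prob_nonneg {n : ℕ} (A : Cube n → Prop) : 0 ≤ prob A :=
  expectation_nonneg fun x => by split_ifs <;> norm_num

theorem prob_mono {n : ℕ} {A B : Cube n → Prop} (h : ∀ x, A x → B x) : prob A ≤ prob B := by
  refine expectation_mono fun x => ?_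
  by_cases hA : A x
  · simp [hA, h x hA]
  · simp only [hA, if_false]; split_ifs <;> norm_num

theorem prob_le_add {n : ℕ} {A B C : Cube n → Prop} (h : ∀ x, A x → B x ∨ C x) :
    prob A ≤ prob B + prob C := by
  rw [prob, prob, prob, ← expectation_add]
  refine expectation_mono fun x => ?_
  have := h x
  by_cases hA : A x <;> by_cases hB : B x <;> by_cases hC : C x <;> simp_all

theorem prob_add_le {n : ℕ} {A B C : Cube n → Prop} (hB : ∀ x, B x → A x) (hC : ∀ x, C x → A x)
    (h : ∀ x, B x → ¬ C x) : prob B + prob C ≤ prob A := by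
  rw [prob, prob, prob, ← expectation_add]
  refine expectation_mono fun x => ?_
  have h1 := h x
  have h2 := hB x
  have h3 := hC x
  by_cases hA : A x <;> by_cases hB : B x <;> by_cases hC : C x <;> simp_all

theorem prob_succ {n : ℕ} (A : Cube (n + 1) → Prop) :
    prob A = (prob (fun x => A (Fin.cons 1 x)) + prob (fun x => A (Fin.cons (-1) x))) / 2 :=
  expectation_succ _

theorem prob_eq_card {n : ℕ} (s : Finset (Cube n)) : (s.card : ℝ) / 2 ^ n = prob (· ∈ s) := by
  have h : ∑ x, (if x ∈ s then (1 : ℝ) else 0) = s.card := by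
    rw [sum_ite_mem, univ_inter, sum_const, nsmul_one]
  rw [prob, expectation, ← h]
  congr!

theorem expectation_halfspace {n : ℕ} (a : Fin n → ℝ) (t : ℝ) :
    expectation (halfspace a t) = prob (fun x => t < linForm a x) := rfl

theorem mem_oneSet_halfspace {n : ℕ} (a : Fin n → ℝ) (t : ℝ) (x : Cube n) :
    x ∈ oneSet (halfspace a t) ↔ t < linForm a x := by
  simp [oneSet, halfspace]

theorem linForm_flipCoord {n : ℕ} (a : Fin n → ℝ) (x : Cube n) (i : Fin n) :
    linForm a (flipCoord x i) = linForm a x - 2 * (a i * ((x i : ℤ) : ℝ)) := by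
  have h : ∀ y : Cube n, linForm a y = a i * ((y i : ℤ) : ℝ) +
      ∑ j ∈ univ.erase i, a j * ((y j : ℤ) : ℝ) := fun y =>
    (add_sum_erase univ (fun j => a j * ((y j : ℤ) : ℝ)) (mem_univ i)).symm
  rw [h, h x, sum_congr rfl (g := fun j => a j * ((x j : ℤ) : ℝ))]
  · simp [flipCoord]; ring
  · intro j hj
    simp [flipCoord, Function.update_of_ne (ne_of_mem_erase hj)]

theorem linForm_neg {n : ℕ} (a : Fin n → ℝ) (x : Cube n) :
    linForm a (x * (-1)) = - linForm a x := by
  simp [linForm]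

theorem prob_neg {n : ℕ} (A : Cube n → Prop) : prob (fun x => A (x * (-1))) = prob A := by
  classical
  exact expectation_mul_right (fun x => if A x then 1 else 0) (-1)

theorem half_le_prob_nonneg {n : ℕ} (a : Fin n → ℝ) :
    1 / 2 ≤ prob (fun x => 0 ≤ linForm a x) := by
  have h1 := prob_neg (fun x => 0 ≤ linForm a x)
  simp only [linForm_neg] at h1
  have h2 : prob (fun _ : Cube n => True) = 1 := by simp [prob, expectation_const]
  have h3 := prob_le_add (n := n) (A := fun _ => True) (B := fun x => 0 ≤ linForm a x)
    (C := fun x => 0 ≤ - linForm a x) (fun x _ => by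
      rcases le_total 0 (linForm a x) with h | h
      · exact Or.inl h
      · exact Or.inr (by linarith))
  linarith

/-! ### Reflection -/

/-- Reflection principle: flipping the coordinates one after the other until their partial sum first
reaches `h` is injective and lowers the linear form by an amount in `[2h, 2h + 2m]`. In the
induction `h` is the level still to be reached; values in `[-m, 0]` occur as the overshoot once the
level has been passed, and no further coordinate is then flipped. -/
theorem prob_interval_le_reflect {n : ℕ} (b : Fin n → ℝ) (m : ℝ) (hb0 : ∀ i, 0 ≤ b i)
    (hbm : ∀ i, b i ≤ m) (h v w : ℝ) (hm : -m ≤ h) (hh : h ≤ 0 ∨ h ≤ v) :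
    prob (fun x => v < linForm b x ∧ linForm b x ≤ w) ≤
      prob (fun x => v - 2 * h - 2 * m < linForm b x ∧ linForm b x ≤ w - 2 * h) := by
  induction n generalizing h v w with
  | zero =>
    refine prob_mono fun x hx => ?_
    have : linForm b x = 0 := by simp [linForm]
    rcases hh with hh | hh
    · constructor <;> linarith [hx.1, hx.2]
    · constructor <;> linarith [hx.1, hx.2]
  | succ n ih =>
    by_cases h0 : h ≤ 0
    · exact prob_mono fun x hx => ⟨by linarith [hx.1], by linarith [hx.2]⟩
    have hv : h ≤ v := by tauto
    have e1 := ih (fun i => b i.succ) (fun i => hb0 _) (fun i => hbm _) (h - b 0) (v - b 0) (w - b 0)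
      (by linarith [hbm 0]) (Or.inr (by linarith))
    have e2 := ih (fun i => b i.succ) (fun i => hb0 _) (fun i => hbm _) (h + b 0) (v + b 0) (w + b 0)
      (by linarith [hb0 0]) (Or.inr (by linarith))
    rw [prob_succ, prob_succ (n := n)]
    simp only [linForm_cons, Units.val_one, Units.val_neg, Int.cast_one, Int.cast_neg]
    have e3 : prob (fun x : Cube n => v < b 0 * 1 + linForm (fun i => b i.succ) x ∧
        b 0 * 1 + linForm (fun i => b i.succ) x ≤ w) ≤
        prob (fun x : Cube n => v - 2 * h - 2 * m < b 0 * -1 + linForm (fun i => b i.succ) x ∧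
        b 0 * -1 + linForm (fun i => b i.succ) x ≤ w - 2 * h) := by
      refine (prob_mono fun x hx => ?_).trans (e1.trans (prob_mono fun x hx => ?_))
      · exact ⟨by linarith [hx.1], by linarith [hx.2]⟩
      · exact ⟨by linarith [hx.1], by linarith [hx.2]⟩
    have e4 : prob (fun x : Cube n => v < b 0 * -1 + linForm (fun i => b i.succ) x ∧
        b 0 * -1 + linForm (fun i => b i.succ) x ≤ w) ≤
        prob (fun x : Cube n => v - 2 * h - 2 * m < b 0 * 1 + linForm (fun i => b i.succ) x ∧
        b 0 * 1 + linForm (fun i => b i.succ) x ≤ w - 2 * h) := by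
      refine (prob_mono fun x hx => ?_).trans (e2.trans (prob_mono fun x hx => ?_))
      · exact ⟨by linarith [hx.1], by linarith [hx.2]⟩
      · exact ⟨by linarith [hx.1], by linarith [hx.2]⟩
    linarith

/-- No interval of length `2 a₁` starting at or above `t` is much likelier than the event that
flipping the first coordinate leaves the halfspace downwards. With `R` the sum over all coordinates
but the first two, the latter event has probability at least a quarter of that of
`R ∈ (t - a₁ - a₂, t + a₁ + a₂]`, whose length is enough for the reflection principle with step
bound `a₂`. -/
theorem prob_interval_le_influence {n : ℕ} (hn : 0 < n) (a : Fin n → ℝ) (ha : Antitone a)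
    (ha0 : ∀ i, 0 ≤ a i) {t u : ℝ} (ht : 0 ≤ t) (hu : t ≤ u) :
    prob (fun x => u < linForm a x ∧ linForm a x ≤ u + 2 * a ⟨0, hn⟩) ≤
      8 * prob (fun x => x ⟨0, hn⟩ = 1 ∧ t < linForm a x ∧ linForm a x ≤ t + 2 * a ⟨0, hn⟩) := by
  match n, hn, a, ha, ha0 with
  | 1, hn, a, ha, ha0 =>
    have h1 : prob (fun x => u < linForm a x ∧ linForm a x ≤ u + 2 * a ⟨0, hn⟩) ≤
      prob (fun x => x ⟨0, hn⟩ = 1 ∧ t < linForm a x ∧ linForm a x ≤ t + 2 * a ⟨0, hn⟩) := by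
      refine prob_mono fun x hx => ?_
      have e : linForm a x = a 0 * ((x 0 : ℤ) : ℝ) := by simp [linForm]
      have h0 := ha0 0
      rcases Int.units_eq_one_or (x 0) with h | h
      · refine ⟨h, by linarith [hx.1], ?_⟩
        rw [e, h]
        simp only [Units.val_one, Int.cast_one, Fin.zero_eta]
        linarith
      · exfalso
        rw [e, h] at hx
        simp only [Units.val_neg, Units.val_one, Int.cast_neg, Int.cast_one] at hx
        linarith [hx.1]
    linarith [prob_nonneg (fun x : Cube 1 => x ⟨0, hn⟩ = 1 ∧ t < linForm a x ∧
      linForm a x ≤ t + 2 * a ⟨0, hn⟩)]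
  | n + 2, hn, a, ha, ha0 =>
    have e0 : (⟨0, hn⟩ : Fin (n + 2)) = 0 := rfl
    rw [e0]
    set a₁ := a 0 with ha₁
    set a₂ := a 1 with ha₂
    have h12 : a₂ ≤ a₁ := ha (Fin.zero_le _)
    have h2 : 0 ≤ a₂ := ha0 _
    set b : Fin n → ℝ := fun i => a i.succ.succ with hb
    have hbm : ∀ i, b i ≤ a₂ := fun i => ha (by simp [Fin.le_def])
    -- The part of `(v, v + 2 a₁]` beyond `t + a₁ + a₂` is reflected, at the level that brings its
    -- upper end to `t + a₁ + a₂`.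
    have key : ∀ v, t - a₁ - a₂ ≤ v →
        prob (fun x => v < linForm b x ∧ linForm b x ≤ v + 2 * a₁) ≤
        2 * prob (fun x => t - a₁ - a₂ < linForm b x ∧ linForm b x ≤ t + a₁ + a₂) := by
      intro v hv
      set v' := max v (t + a₁ + a₂) with hv'
      have hv1 : v ≤ v' := le_max_left _ _
      have hv2 : t + a₁ + a₂ ≤ v' := le_max_right _ _
      have r1 := prob_le_add (n := n)
        (A := fun x => v < linForm b x ∧ linForm b x ≤ v + 2 * a₁)
        (B := fun x => t - a₁ - a₂ < linForm b x ∧ linForm b x ≤ t + a₁ + a₂)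
        (C := fun x => v' < linForm b x ∧ linForm b x ≤ v' + 2 * a₁) (by
          intro x hx
          by_cases hc : linForm b x ≤ t + a₁ + a₂
          · exact Or.inl ⟨by linarith [hx.1], hc⟩
          · exact Or.inr ⟨max_lt hx.1 (not_le.1 hc), by linarith [hx.2]⟩)
      have r2 := prob_interval_le_reflect b a₂ (fun i => ha0 _) hbm ((v' + a₁ - a₂ - t) / 2) v'
        (v' + 2 * a₁) (by linarith) (Or.inr (by linarith))
      have r3 := r2.trans (prob_mono (B := fun x => t - a₁ - a₂ < linForm b x ∧
        linForm b x ≤ t + a₁ + a₂) fun x hx => ⟨by linarith [hx.1], by linarith [hx.2]⟩)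
      linarith
    have hs : ∀ (y₁ y₂ : ℤˣ) (x : Cube n), linForm a (Fin.cons y₁ (Fin.cons y₂ x)) =
        a₁ * ((y₁ : ℤ) : ℝ) + (a₂ * ((y₂ : ℤ) : ℝ) + linForm b x) := by
      intro y₁ y₂ x
      rw [linForm_cons, linForm_cons]
      rfl
    have neg_ne : ((-1 : ℤˣ) = 1) = False := by decide
    simp only [prob_succ, hs, Fin.cons_zero, neg_ne, false_and, true_and, Units.val_one,
      Units.val_neg, Int.cast_one, Int.cast_neg]
    have f0 : prob (fun _ : Cube n => False) = 0 := by simp [prob, expectation_const]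
    rw [f0]
    have k1 := key (u - a₁ - a₂) (by linarith)
    have k2 := key (u - a₁ + a₂) (by linarith)
    have k3 := key (u + a₁ - a₂) (by linarith)
    have k4 := key (u + a₁ + a₂) (by linarith)
    have g1 : prob (fun x : Cube n => u < a₁ * 1 + (a₂ * 1 + linForm b x) ∧
        a₁ * 1 + (a₂ * 1 + linForm b x) ≤ u + 2 * a₁) ≤ _ :=
      (prob_mono fun x hx => ⟨by linarith [hx.1], by linarith [hx.2]⟩).trans k1
    have g2 : prob (fun x : Cube n => u < a₁ * 1 + (a₂ * -1 + linForm b x) ∧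
        a₁ * 1 + (a₂ * -1 + linForm b x) ≤ u + 2 * a₁) ≤ _ :=
      (prob_mono fun x hx => ⟨by linarith [hx.1], by linarith [hx.2]⟩).trans k2
    have g3 : prob (fun x : Cube n => u < a₁ * -1 + (a₂ * 1 + linForm b x) ∧
        a₁ * -1 + (a₂ * 1 + linForm b x) ≤ u + 2 * a₁) ≤ _ :=
      (prob_mono fun x hx => ⟨by linarith [hx.1], by linarith [hx.2]⟩).trans k3
    have g4 : prob (fun x : Cube n => u < a₁ * -1 + (a₂ * -1 + linForm b x) ∧
        a₁ * -1 + (a₂ * -1 + linForm b x) ≤ u + 2 * a₁) ≤ _ :=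
      (prob_mono fun x hx => ⟨by linarith [hx.1], by linarith [hx.2]⟩).trans k4
    have fin := prob_le_add (n := n)
      (A := fun x => t - a₁ - a₂ < linForm b x ∧ linForm b x ≤ t + a₁ + a₂)
      (B := fun x => t < a₁ * 1 + (a₂ * 1 + linForm b x) ∧
        a₁ * 1 + (a₂ * 1 + linForm b x) ≤ t + 2 * a₁)
      (C := fun x => t < a₁ * 1 + (a₂ * -1 + linForm b x) ∧
        a₁ * 1 + (a₂ * -1 + linForm b x) ≤ t + 2 * a₁) (by
        intro x hx
        by_cases hc : linForm b x ≤ t + a₁ - a₂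
        · exact Or.inl ⟨by linarith [hx.1], by linarith⟩
        · exact Or.inr ⟨by linarith, by linarith [hx.2]⟩)
    linarith

/-! ### Hoeffding's inequality -/

theorem expectation_exp_linForm_le {n : ℕ} (a : Fin n → ℝ) (l : ℝ) :
    expectation (fun x => Real.exp (l * linForm a x)) ≤
      Real.exp (l ^ 2 * (∑ i, a i ^ 2) / 2) := by
  induction n with
  | zero => rw [expectation_eq_biasedExp, biasedExp_zero]; simp [linForm]
  | succ n ih =>
    rw [expectation_succ]
    have h : ∀ (b : ℤˣ), expectation (fun z : Cube n => Real.exp (l * linForm a (Fin.cons b z))) =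
        Real.exp (l * a 0 * ((b : ℤ) : ℝ)) *
          expectation (fun z => Real.exp (l * linForm (fun i => a i.succ) z)) := by
      intro b
      rw [← expectation_const_mul]
      congr 1
      ext z
      rw [linForm_cons, ← Real.exp_add]
      ring_nf
    rw [h, h, Fin.sum_univ_succ]
    have h1 := ih (fun i => a i.succ)
    have h2 := Real.cosh_le_exp_half_sq (l * a 0)
    have h3 : 0 ≤ Real.cosh (l * a 0) := (Real.cosh_pos _).le
    calc _ = Real.cosh (l * a 0) *
          expectation (fun z => Real.exp (l * linForm (fun i => a i.succ) z)) := by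
          rw [Real.cosh_eq]; simp; ring
      _ ≤ Real.exp ((l * a 0) ^ 2 / 2) *
          Real.exp (l ^ 2 * (∑ i : Fin n, a i.succ ^ 2) / 2) :=
          mul_le_mul h2 h1 (expectation_nonneg fun _ => (Real.exp_pos _).le) (Real.exp_pos _).le
      _ = _ := by rw [← Real.exp_add]; ring_nf

theorem prob_lt_linForm_le_exp {n : ℕ} (a : Fin n → ℝ) (ha : ∑ i, a i ^ 2 = 1) {t : ℝ}
    (ht : 0 ≤ t) : prob (fun x => t < linForm a x) ≤ Real.exp (-(t ^ 2 / 2)) := by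
  have h1 := expectation_exp_linForm_le a t
  have h2 : prob (fun x => t < linForm a x) ≤
      Real.exp (-t ^ 2) * expectation (fun x => Real.exp (t * linForm a x)) := by
    rw [prob, ← expectation_const_mul]
    refine expectation_mono fun x => ?_
    rw [← Real.exp_add]
    split_ifs with h
    · exact Real.one_le_exp (by nlinarith)
    · exact (Real.exp_pos _).le
  refine h2.trans ((mul_le_mul_of_nonneg_left h1 (Real.exp_pos _).le).trans ?_)
  rw [← Real.exp_add, ha]
  apply Real.exp_le_exp.2
  linarith

/-- Hoeffding's inequality, solved for the threshold. -/
theorem threshold_le_sqrt {n : ℕ} (a : Fin n → ℝ) (ha : ∑ i, a i ^ 2 = 1) {t : ℝ}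
    (ht : 0 ≤ t) (h0 : 0 < prob (fun x => t < linForm a x)) :
    t ≤ 3 / 2 * √(Real.log (1 / prob (fun x => t < linForm a x))) := by
  have h := Real.log_le_log h0 (prob_lt_linForm_le_exp a ha ht)
  rw [Real.log_exp] at h
  rw [one_div, Real.log_inv]
  have : t ^ 2 ≤ 2 * -Real.log (prob fun x => t < linForm a x) := by linarith
  have h1 := Real.sq_sqrt (show 0 ≤ -Real.log (prob fun x => t < linForm a x) by nlinarith)
  have h2 := Real.sqrt_nonneg (-Real.log (prob fun x => t < linForm a x))
  nlinarith

/-! ### The noise operator and small-set expansion -/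

/-- The noise operator: the average of `f` over the points obtained from `x` by flipping each
coordinate independently with probability `ρ`. Flipping is multiplication in the group `Cube n`. -/
noncomputable def noise (ρ : ℝ) {n : ℕ} (f : Cube n → ℝ) (x : Cube n) : ℝ :=
  biasedExp ρ (fun z => f (x * z))

theorem cons_mul_cons {n : ℕ} (b c : ℤˣ) (x z : Cube n) :
    (Fin.cons b x : Cube (n + 1)) * (Fin.cons c z : Cube (n + 1)) = Fin.cons (b * c) (x * z) := by
  funext i
  refine Fin.cases ?_ (fun j => ?_) i <;> simp

theorem noise_cons (ρ : ℝ) {n : ℕ} (f : Cube (n + 1) → ℝ) (b : ℤˣ) (x : Cube n) :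
    noise ρ f (Fin.cons b x) = (1 - ρ) * noise ρ (fun y => f (Fin.cons b y)) x +
      ρ * noise ρ (fun y => f (Fin.cons (-b) y)) x := by
  simp [noise, biasedExp_succ, cons_mul_cons]

theorem expectation_mul_noise_succ (ρ : ℝ) {n : ℕ} (f g : Cube (n + 1) → ℝ) :
    expectation (fun x => f x * noise ρ g x) =
      (1 - ρ) / 2 * (expectation (fun x => f (Fin.cons 1 x) * noise ρ (fun y => g (Fin.cons 1 y)) x) +
        expectation (fun x => f (Fin.cons (-1) x) * noise ρ (fun y => g (Fin.cons (-1) y)) x)) +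
      ρ / 2 * (expectation (fun x => f (Fin.cons 1 x) * noise ρ (fun y => g (Fin.cons (-1) y)) x) +
        expectation (fun x => f (Fin.cons (-1) x) * noise ρ (fun y => g (Fin.cons 1 y)) x)) := by
  have h : ∀ (u p q : Cube n → ℝ), expectation (fun x => u x * ((1 - ρ) * p x + ρ * q x)) =
      (1 - ρ) * expectation (fun x => u x * p x) + ρ * expectation (fun x => u x * q x) := by
    intro u p q
    rw [← expectation_const_mul, ← expectation_const_mul, ← expectation_add]
    congr 1
    ext x
    ring
  rw [expectation_succ]
  simp only [noise_cons, h, neg_neg]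
  ring

/-- Semigroup property: two rounds of noise of rate `ρ` are one round of rate `2ρ(1 - ρ)`, so that
the correlations `1 - 2ρ` multiply. -/
theorem expectation_noise_mul_noise (ρ : ℝ) {n : ℕ} (f g : Cube n → ℝ) :
    expectation (fun x => noise ρ f x * noise ρ g x) =
      expectation (fun x => f x * noise (2 * ρ * (1 - ρ)) g x) := by
  induction n with
  | zero => simp [noise, expectation_eq_biasedExp, biasedExp_zero]
  | succ n ih =>
    have h : ∀ (p q u v : Cube n → ℝ) (a b c d : ℝ),
        expectation (fun x => (a * p x + b * q x) * (c * u x + d * v x)) =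
        a * c * expectation (fun x => p x * u x) + a * d * expectation (fun x => p x * v x) +
        b * c * expectation (fun x => q x * u x) + b * d * expectation (fun x => q x * v x) := by
      intro p q u v a b c d
      simp only [← expectation_const_mul, ← expectation_add]
      congr 1
      ext x
      ring
    rw [expectation_succ, expectation_mul_noise_succ]
    simp only [noise_cons, h, neg_neg, ih]
    ring

theorem expectation_mul_sq_le {n : ℕ} (f g : Cube n → ℝ) :
    expectation (fun x => f x * g x) ^ 2 ≤
      expectation (fun x => f x ^ 2) * expectation (fun x => g x ^ 2) := by
  simp only [expectation, div_pow, div_mul_div_comm]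
  rw [← sq ((2 : ℝ) ^ n)]
  exact div_le_div_of_nonneg_right (sum_mul_sq_le_sq_mul_sq _ _ _) (by positivity)

/-- Hypercontractivity on the one-dimensional cube, in squared form: for the function `f` with values
`u ^ 3` and `v ^ 3`, the correlation of `f` with its noisy copy at correlation `1/3` is at most the
square of the `L ^ (4/3)` norm of `f`. The difference of the two sides is divisible by
`(u - v) ^ 4`. -/
theorem two_point_ineq {u v : ℝ} (hu : 0 ≤ u) (hv : 0 ≤ v) :
    ((u ^ 6 + v ^ 6 + u ^ 3 * v ^ 3) / 3) ^ 2 ≤ ((u ^ 4 + v ^ 4) / 2) ^ 3 := by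
  have h : 0 ≤ (u - v) ^ 4 * (u ^ 8 + v ^ 8 + 4 * u ^ 7 * v + 4 * u * v ^ 7 + 8 * u ^ 6 * v ^ 2 +
      8 * u ^ 2 * v ^ 6 + 4 * u ^ 5 * v ^ 3 + 4 * u ^ 3 * v ^ 5 + 2 * u ^ 4 * v ^ 4
      + 2 * u ^ 2 * v ^ 2 * (u ^ 2 - v ^ 2) ^ 2) := by
    positivity
  nlinarith [h]

theorem two_point_bilinear {p₀ p₁ q₀ q₁ : ℝ} (hp₀ : 0 ≤ p₀) (hp₁ : 0 ≤ p₁) (hq₀ : 0 ≤ q₀)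
    (hq₁ : 0 ≤ q₁) :
    ((p₀ ^ 3 * q₀ ^ 3 + p₁ ^ 3 * q₁ ^ 3) / 3 + (p₀ ^ 3 * q₁ ^ 3 + p₁ ^ 3 * q₀ ^ 3) / 6) ^ 4 ≤
      ((p₀ ^ 4 + p₁ ^ 4) / 2 * ((q₀ ^ 4 + q₁ ^ 4) / 2)) ^ 3 := by
  have h1 := two_point_ineq hp₀ hp₁
  have h2 := two_point_ineq hq₀ hq₁
  have h3 : ((p₀ ^ 3 * q₀ ^ 3 + p₁ ^ 3 * q₁ ^ 3) / 3 + (p₀ ^ 3 * q₁ ^ 3 + p₁ ^ 3 * q₀ ^ 3) / 6) ^ 2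
      ≤ ((p₀ ^ 6 + p₁ ^ 6 + p₀ ^ 3 * p₁ ^ 3) / 3) * ((q₀ ^ 6 + q₁ ^ 6 + q₀ ^ 3 * q₁ ^ 3) / 3) := by
    nlinarith [sq_nonneg (p₀ ^ 3 * q₁ ^ 3 - p₁ ^ 3 * q₀ ^ 3)]
  calc _ = (((p₀ ^ 3 * q₀ ^ 3 + p₁ ^ 3 * q₁ ^ 3) / 3 +
        (p₀ ^ 3 * q₁ ^ 3 + p₁ ^ 3 * q₀ ^ 3) / 6) ^ 2) ^ 2 := by ring
    _ ≤ (((p₀ ^ 6 + p₁ ^ 6 + p₀ ^ 3 * p₁ ^ 3) / 3) *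
        ((q₀ ^ 6 + q₁ ^ 6 + q₀ ^ 3 * q₁ ^ 3) / 3)) ^ 2 := by gcongr
    _ = ((p₀ ^ 6 + p₁ ^ 6 + p₀ ^ 3 * p₁ ^ 3) / 3) ^ 2 *
        ((q₀ ^ 6 + q₁ ^ 6 + q₀ ^ 3 * q₁ ^ 3) / 3) ^ 2 := by ring
    _ ≤ ((p₀ ^ 4 + p₁ ^ 4) / 2) ^ 3 * ((q₀ ^ 4 + q₁ ^ 4) / 2) ^ 3 := by gcongr
    _ = _ := by ring

theorem biasedExp_nonneg {ρ : ℝ} (h0 : 0 ≤ ρ) (h1 : ρ ≤ 1) {n : ℕ} {F : Cube n → ℝ}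
    (h : ∀ z, 0 ≤ F z) : 0 ≤ biasedExp ρ F := by
  simpa [biasedExp_const] using biasedExp_mono h0 h1 h

theorem exists_pow_four_eq {x : ℝ} (hx : 0 ≤ x) : ∃ p : ℝ, 0 ≤ p ∧ p ^ 4 = x :=
  ⟨√(√x), Real.sqrt_nonneg _, by
    rw [show (4 : ℕ) = 2 * 2 from rfl, pow_mul, Real.sq_sqrt (Real.sqrt_nonneg _), Real.sq_sqrt hx]⟩

/-- The two-function hypercontractive inequality at correlation `1/3`, for functions with values in
`[0, 1]`. -/
theorem expectation_mul_noise_pow_four_le {n : ℕ} (f g : Cube n → ℝ) (hf0 : ∀ x, 0 ≤ f x)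
    (hf1 : ∀ x, f x ≤ 1) (hg0 : ∀ x, 0 ≤ g x) (hg1 : ∀ x, g x ≤ 1) :
    expectation (fun x => f x * noise (1 / 3) g x) ^ 4 ≤ (expectation f * expectation g) ^ 3 := by
  induction n with
  | zero =>
    simp only [noise, expectation_eq_biasedExp, biasedExp_zero, mul_one]
    exact pow_le_pow_of_le_one (mul_nonneg (hf0 _) (hg0 _))
      (mul_le_one₀ (hf1 _) (hg0 _) (hg1 _)) (by norm_num)
  | succ n ih =>
    have aux : ∀ (f g : Cube n → ℝ) (p q : ℝ), (∀ x, 0 ≤ f x) → (∀ x, f x ≤ 1) →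
        (∀ x, 0 ≤ g x) → (∀ x, g x ≤ 1) → 0 ≤ p → 0 ≤ q → p ^ 4 = expectation f →
        q ^ 4 = expectation g →
        expectation (fun x => f x * noise (1 / 3) g x) ≤ p ^ 3 * q ^ 3 := by
      intro f g p q h1 h2 h3 h4 hp hq e1 e2
      have := ih f g h1 h2 h3 h4
      rw [← e1, ← e2, show (p ^ 4 * q ^ 4) ^ 3 = (p ^ 3 * q ^ 3) ^ 4 by ring] at this
      exact le_of_pow_le_pow_left₀ (by norm_num) (by positivity) this
    have nn : ∀ (f g : Cube n → ℝ), (∀ x, 0 ≤ f x) → (∀ x, 0 ≤ g x) →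
        0 ≤ expectation (fun x => f x * noise (1 / 3) g x) := fun f g h1 h2 =>
      expectation_nonneg fun x => mul_nonneg (h1 x)
        (biasedExp_nonneg (by norm_num) (by norm_num) fun z => h2 _)
    obtain ⟨p₀, hp₀, ep₀⟩ := exists_pow_four_eq (expectation_nonneg (fun z => hf0 (Fin.cons 1 z)))
    obtain ⟨p₁, hp₁, ep₁⟩ := exists_pow_four_eq (expectation_nonneg (fun z => hf0 (Fin.cons (-1) z)))
    obtain ⟨q₀, hq₀, eq₀⟩ := exists_pow_four_eq (expectation_nonneg (fun z => hg0 (Fin.cons 1 z)))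
    obtain ⟨q₁, hq₁, eq₁⟩ := exists_pow_four_eq (expectation_nonneg (fun z => hg0 (Fin.cons (-1) z)))
    rw [expectation_mul_noise_succ, expectation_succ f, expectation_succ g, ← ep₀, ← ep₁, ← eq₀,
      ← eq₁]
    refine le_trans ?_ (two_point_bilinear hp₀ hp₁ hq₀ hq₁)
    have a00 := aux _ _ p₀ q₀ (fun z => hf0 (Fin.cons 1 z)) (fun z => hf1 _)
      (fun z => hg0 (Fin.cons 1 z)) (fun z => hg1 _) hp₀ hq₀ ep₀ eq₀
    have a01 := aux _ _ p₀ q₁ (fun z => hf0 (Fin.cons 1 z)) (fun z => hf1 _)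
      (fun z => hg0 (Fin.cons (-1) z)) (fun z => hg1 _) hp₀ hq₁ ep₀ eq₁
    have a10 := aux _ _ p₁ q₀ (fun z => hf0 (Fin.cons (-1) z)) (fun z => hf1 _)
      (fun z => hg0 (Fin.cons 1 z)) (fun z => hg1 _) hp₁ hq₀ ep₁ eq₀
    have a11 := aux _ _ p₁ q₁ (fun z => hf0 (Fin.cons (-1) z)) (fun z => hf1 _)
      (fun z => hg0 (Fin.cons (-1) z)) (fun z => hg1 _) hp₁ hq₁ ep₁ eq₁
    have b00 := nn _ _ (fun z => hf0 (Fin.cons 1 z)) (fun z => hg0 (Fin.cons 1 z))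
    have b01 := nn _ _ (fun z => hf0 (Fin.cons 1 z)) (fun z => hg0 (Fin.cons (-1) z))
    have b10 := nn _ _ (fun z => hf0 (Fin.cons (-1) z)) (fun z => hg0 (Fin.cons 1 z))
    have b11 := nn _ _ (fun z => hf0 (Fin.cons (-1) z)) (fun z => hg0 (Fin.cons (-1) z))
    refine pow_le_pow_left₀ ?_ ?_ 4 <;> linarith

/-- Small-set expansion at correlation `3 ^ (-1 / 2 ^ j)`. The Cauchy–Schwarz inequality and the
semigroup property bring the case `j + 1` back to the case `j`, and hypercontractivity is the case
`j = 0`. -/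
theorem expectation_mul_noise_pow_le {n : ℕ} (f : Cube n → ℝ) (hf : ∀ x, f x = 0 ∨ f x = 1) (j : ℕ) :
    expectation (fun x => f x * noise ((1 - Real.exp (-Real.log 3 / 2 ^ j)) / 2) f x) ^
      (2 * 2 ^ j) ≤ expectation f ^ (2 * 2 ^ j + 1) := by
  have hf0 : ∀ x, 0 ≤ f x := fun x => by rcases hf x with h | h <;> simp [h]
  have hf1 : ∀ x, f x ≤ 1 := fun x => by rcases hf x with h | h <;> simp [h]
  have he := expectation_nonneg hf0
  induction j with
  | zero =>
    have h := expectation_mul_noise_pow_four_le f f hf0 hf1 hf0 hf1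
    rw [pow_zero, div_one, Real.exp_neg, Real.exp_log (by norm_num),
      show ((1 - (3 : ℝ)⁻¹) / 2) = 1 / 3 by norm_num]
    refine le_of_pow_le_pow_left₀ (n := 2) (by norm_num) (by positivity) ?_
    calc _ = _ := (pow_mul _ 2 2).symm
      _ ≤ _ := h
      _ = _ := by ring
  | succ j ih =>
    set r := Real.exp (-Real.log 3 / 2 ^ (j + 1)) with hr
    have hr2 : Real.exp (-Real.log 3 / 2 ^ j) = r ^ 2 := by
      rw [hr, ← Real.exp_nat_mul]
      congr 1
      rw [pow_succ]
      push_cast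
      field_simp
    rw [hr2] at ih
    have h1 := expectation_mul_sq_le f (noise ((1 - r) / 2) f)
    simp only [sq (noise _ f _)] at h1
    rw [expectation_noise_mul_noise, show 2 * ((1 - r) / 2) * (1 - (1 - r) / 2) = (1 - r ^ 2) / 2 by
      ring, show (fun x => f x ^ 2) = f by
        ext x; rcases hf x with h | h <;> simp [h]] at h1
    calc _ = (expectation (fun x => f x * noise ((1 - r) / 2) f x) ^ 2) ^ (2 * 2 ^ j) := by
          rw [← pow_mul]; congr 1; ring
      _ ≤ (expectation f * expectation (fun x => f x * noise ((1 - r ^ 2) / 2) f x)) ^ (2 * 2 ^ j) :=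
          pow_le_pow_left₀ (by positivity) h1 _
      _ ≤ expectation f ^ (2 * 2 ^ j) * expectation f ^ (2 * 2 ^ j + 1) := by
          rw [mul_pow]; gcongr
      _ = _ := by rw [← pow_add]; congr 1; ring

/-- At some noise rate of order at most `1 / log (1 / E f)`, a uniform point of the set and its noisy
copy both lie in the set with probability at most `E f / √2`. -/
theorem exists_noise_stability_le {n : ℕ} (f : Cube n → ℝ) (hf : ∀ x, f x = 0 ∨ f x = 1)
    (h0 : 0 < expectation f) (h1 : expectation f ≤ 1 / 2) :
    ∃ ρ : ℝ, 0 < ρ ∧ ρ ≤ 1 / 3 ∧ ρ * Real.log (1 / expectation f) ≤ 1 ∧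
      expectation (fun x => f x * noise ρ f x) ^ 2 ≤ expectation f ^ 2 / 2 := by
  set ε := expectation f with hε
  set L := Real.log (1 / ε) with hL
  have hlog2 : 0 < Real.log 2 := Real.log_pos (by norm_num)
  have hL2 : Real.log 2 ≤ L := Real.log_le_log (by norm_num) (by rw [le_div_iff₀ h0]; linarith)
  have hexp : ε = Real.exp (-L) := by
    rw [hL, one_div, Real.log_inv, neg_neg, Real.exp_log h0]
  -- With `2 ^ j` within a factor `2` of `L / log 2`, the gain `ε ^ (1 / (2 * 2 ^ j))` of small-set
  -- expansion is at most `1 / √2`.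
  obtain ⟨j, hj1, hj2⟩ := exists_nat_pow_near (x := L / Real.log 2) (y := 2)
    (by rwa [le_div_iff₀ hlog2, one_mul]) (by norm_num)
  rw [le_div_iff₀ hlog2] at hj1
  rw [div_lt_iff₀ hlog2] at hj2
  have hM : (1 : ℝ) ≤ 2 ^ j := one_le_pow₀ (by norm_num)
  have hl3 : 0 < Real.log 3 := Real.log_pos (by norm_num)
  have hl3' : Real.log 3 ≤ 2 * Real.log 2 := by
    rw [← Real.log_rpow (by norm_num)]
    exact Real.log_le_log (by norm_num) (by norm_num)
  have hl2 := Real.log_two_lt_d9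
  refine ⟨(1 - Real.exp (-Real.log 3 / 2 ^ j)) / 2, ?_, ?_, ?_, ?_⟩
  · have : Real.exp (-Real.log 3 / 2 ^ j) < 1 :=
      Real.exp_lt_one_iff.2 (div_neg_of_neg_of_pos (by linarith) (by positivity))
    linarith
  · have : Real.exp (-Real.log 3) ≤ Real.exp (-Real.log 3 / 2 ^ j) := by
      apply Real.exp_le_exp.2
      rw [neg_div]
      exact neg_le_neg (div_le_self hl3.le hM)
    rw [Real.exp_neg, Real.exp_log (by norm_num)] at this
    linarith
  · have h2 := Real.add_one_le_exp (-Real.log 3 / 2 ^ j)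
    have h3 : (1 - Real.exp (-Real.log 3 / 2 ^ j)) / 2 ≤ Real.log 3 / (2 * 2 ^ j) := by
      have : Real.log 3 / (2 * 2 ^ j) = -(-Real.log 3 / 2 ^ j) / 2 := by field_simp
      rw [this]; linarith
    calc _ ≤ Real.log 3 / (2 * 2 ^ j) * (2 ^ (j + 1) * Real.log 2) := by
          apply mul_le_mul h3 hj2.le (by linarith) (by positivity)
      _ = Real.log 3 * Real.log 2 := by rw [pow_succ]; field_simp
      _ ≤ 1 := by nlinarith
  · have h := expectation_mul_noise_pow_le f hf j
    rw [← hε] at h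
    refine le_of_pow_le_pow_left₀ (n := 2 ^ j) (by positivity) (by positivity) ?_
    rw [← pow_mul, div_pow, ← pow_mul]
    refine h.trans ?_
    rw [pow_succ, div_eq_mul_inv]
    gcongr
    rw [hexp, Real.exp_neg]
    gcongr
    rw [← Real.exp_log (show (0 : ℝ) < 2 by norm_num), ← Real.exp_nat_mul]
    apply Real.exp_le_exp.2
    simpa [Real.exp_log] using hj1

/-! ### Moments of biased linear forms -/

/-- The linear form with coefficients `c` in biased bits, centred: a bit which is `-1` with
probability `ρ` has mean `1 - 2ρ`. -/
def centeredForm (ρ : ℝ) {n : ℕ} (c : Fin n → ℝ) (z : Cube n) : ℝ :=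
  ∑ i, c i * (((z i : ℤ) : ℝ) - (1 - 2 * ρ))

theorem centeredForm_cons (ρ : ℝ) {n : ℕ} (c : Fin (n + 1) → ℝ) (b : ℤˣ) (z : Cube n) :
    centeredForm ρ c (Fin.cons b z) =
      c 0 * (((b : ℤ) : ℝ) - (1 - 2 * ρ)) + centeredForm ρ (fun i => c i.succ) z := by
  simp [centeredForm, Fin.sum_univ_succ]

theorem biasedExp_add_sq (ρ : ℝ) {n : ℕ} (k : ℝ) (F : Cube n → ℝ) :
    biasedExp ρ (fun z => (k + F z) ^ 2) =
      k ^ 2 + 2 * k * biasedExp ρ F + biasedExp ρ (fun z => F z ^ 2) := by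
  rw [← biasedExp_const ρ (n := n) (k ^ 2), ← biasedExp_const_mul, ← biasedExp_add,
    ← biasedExp_add]
  congr 1
  ext z
  ring

theorem biasedExp_add_pow_four (ρ : ℝ) {n : ℕ} (k : ℝ) (F : Cube n → ℝ) :
    biasedExp ρ (fun z => (k + F z) ^ 4) =
      k ^ 4 + 4 * k ^ 3 * biasedExp ρ F + 6 * k ^ 2 * biasedExp ρ (fun z => F z ^ 2) +
      4 * k * biasedExp ρ (fun z => F z ^ 3) + biasedExp ρ (fun z => F z ^ 4) := by
  rw [← biasedExp_const ρ (n := n) (k ^ 4)]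
  simp only [← biasedExp_const_mul, ← biasedExp_add]
  congr 1
  ext z
  ring

theorem biasedExp_centeredForm (ρ : ℝ) {n : ℕ} (c : Fin n → ℝ) :
    biasedExp ρ (centeredForm ρ c) = 0 := by
  induction n with
  | zero => rw [biasedExp_zero]; simp [centeredForm]
  | succ n ih =>
    rw [biasedExp_succ]
    simp only [centeredForm_cons, biasedExp_add, biasedExp_const, ih]
    push_cast
    ring

theorem biasedExp_centeredForm_sq (ρ : ℝ) {n : ℕ} (c : Fin n → ℝ) :
    biasedExp ρ (fun z => centeredForm ρ c z ^ 2) = 4 * ρ * (1 - ρ) * ∑ i, c i ^ 2 := by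
  induction n with
  | zero => rw [biasedExp_zero]; simp [centeredForm]
  | succ n ih =>
    rw [biasedExp_succ]
    simp only [centeredForm_cons, biasedExp_add_sq, biasedExp_centeredForm, ih, Fin.sum_univ_succ]
    push_cast
    ring

theorem biasedExp_centeredForm_pow_four_le {ρ : ℝ} (h0 : 0 ≤ ρ) (h1 : ρ ≤ 1) {n : ℕ}
    (c : Fin n → ℝ) :
    biasedExp ρ (fun z => centeredForm ρ c z ^ 4) ≤
      4 * (4 * ρ * (1 - ρ)) * ∑ i, c i ^ 4 +
        3 * (4 * ρ * (1 - ρ)) ^ 2 * (∑ i, c i ^ 2) ^ 2 := by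
  induction n with
  | zero => rw [biasedExp_zero]; simp [centeredForm]
  | succ n ih =>
    rw [biasedExp_succ]
    simp only [centeredForm_cons, biasedExp_add_pow_four, biasedExp_centeredForm,
      biasedExp_centeredForm_sq, Fin.sum_univ_succ]
    have := ih (fun i => c i.succ)
    set A := biasedExp ρ (fun z => centeredForm ρ (fun i => c i.succ) z ^ 4)
    set B := ∑ i : Fin n, c i.succ ^ 4
    set C := ∑ i : Fin n, c i.succ ^ 2
    have hq : 0 ≤ ρ * (1 - ρ) := mul_nonneg h0 (by linarith)
    have e1 : 0 ≤ (ρ * (1 - ρ)) ^ 2 * c 0 ^ 4 := by positivity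
    push_cast
    nlinarith [e1]

theorem linForm_mul (ρ : ℝ) {n : ℕ} (a : Fin n → ℝ) (x z : Cube n) :
    linForm a (x * z) = centeredForm ρ (fun i => a i * ((x i : ℤ) : ℝ)) z +
      (1 - 2 * ρ) * linForm a x := by
  simp only [linForm, centeredForm, mul_sum, ← sum_add_distrib]
  refine sum_congr rfl fun i _ => ?_
  simp only [Pi.mul_apply, Units.val_mul, Int.cast_mul]
  ring

theorem unit_sq (b : ℤˣ) : ((b : ℤ) : ℝ) ^ 2 = 1 := by
  rcases Int.units_eq_one_or b with h | h <;> simp [h]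

/-! ### Local Chernoff inequalities -/

/-- Local Chernoff inequality: raising the threshold by `36 / √(log (1 / ε))` loses at least a
quarter of the measure `ε` of the halfspace. -/
theorem prob_add_shift_le {n : ℕ} (a : Fin n → ℝ) (ha : ∑ i, a i ^ 2 = 1) {t : ℝ} (ht : 0 ≤ t)
    (h0 : 0 < prob (fun x => t < linForm a x)) (h1 : prob (fun x => t < linForm a x) ≤ 1 / 2) :
    prob (fun x => t + 36 / √(Real.log (1 / prob (fun x => t < linForm a x))) < linForm a x) ≤
      3 / 4 * prob (fun x => t < linForm a x) := by
  classical
  set ε := prob (fun x => t < linForm a x) with hε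
  have htL := threshold_le_sqrt a ha ht h0
  rw [← hε] at htL
  set L := Real.log (1 / ε) with hL
  have hLpos : 0 < L := Real.log_pos (by rw [lt_div_iff₀ h0]; linarith)
  set R := √L with hR
  have hRpos : 0 < R := Real.sqrt_pos.2 hLpos
  have hR2 : R ^ 2 = L := Real.sq_sqrt hLpos.le
  set f : Cube n → ℝ := halfspace a t with hf
  have hf01 : ∀ x, f x = 0 ∨ f x = 1 := fun x => by
    simp only [hf, halfspace]; split_ifs <;> simp
  have hfe : expectation f = ε := rfl
  obtain ⟨ρ, hρ0, hρ1, hρL, hN⟩ := exists_noise_stability_le f hf01 h0 h1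
  rw [hfe, ← hL] at hρL
  rw [hfe] at hN
  -- Chebyshev's inequality for the noisy copy of a point well above the threshold.
  have hnoise : ∀ x, t + 36 / R < linForm a x → 19 / 20 ≤ noise ρ f x := by
    intro x hx
    set D := (1 - 2 * ρ) * linForm a x - t with hD
    have hρR : ρ * R ≤ 1 / R := by
      rw [le_div_iff₀ hRpos, mul_assoc, ← sq, hR2]; exact hρL
    have hD9 : 9 / R ≤ D := by
      have e1 : (1 - 2 * ρ) * (t + 36 / R) ≤ (1 - 2 * ρ) * linForm a x :=
        mul_le_mul_of_nonneg_left hx.le (by linarith)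
      have e2 : ρ * t ≤ 3 / 2 * (1 / R) := by
        calc ρ * t ≤ ρ * (3 / 2 * R) := mul_le_mul_of_nonneg_left htL hρ0.le
          _ = 3 / 2 * (ρ * R) := by ring
          _ ≤ _ := by linarith
      have e3 : 0 < 1 / R := by positivity
      have e4 : 36 / R = 36 * (1 / R) := by ring
      have e5 : 9 / R = 9 * (1 / R) := by ring
      rw [e4] at e1
      rw [e5]
      nlinarith
    have hDpos : 0 < D := lt_of_lt_of_le (by positivity) hD9
    have hD2 : 81 * ρ ≤ D ^ 2 := by
      have e : (9 / R) ^ 2 ≤ D ^ 2 := pow_le_pow_left₀ (by positivity) hD9 2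
      rw [div_pow, hR2, div_le_iff₀ hLpos] at e
      have : 81 * ρ * L ≤ D ^ 2 * L := by linarith
      exact le_of_mul_le_mul_right this hLpos
    set c : Fin n → ℝ := fun i => a i * ((x i : ℤ) : ℝ) with hc
    have hc2 : ∑ i, c i ^ 2 = 1 := by simp only [hc, mul_pow, unit_sq, mul_one, ha]
    have hY := biasedExp_centeredForm_sq ρ c
    rw [hc2, mul_one] at hY
    have hm : biasedExp ρ (fun z => 1 - (D ^ 2)⁻¹ * centeredForm ρ c z ^ 2) ≤ noise ρ f x := by
      refine biasedExp_mono hρ0.le (by linarith) fun z => ?_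
      simp only [hf, halfspace, linForm_mul ρ]
      split_ifs with hz
      · have : 0 ≤ (D ^ 2)⁻¹ * centeredForm ρ c z ^ 2 := by positivity
        linarith
      · have h1 : D ≤ - centeredForm ρ c z := by linarith
        have h2 : D ^ 2 ≤ centeredForm ρ c z ^ 2 := by nlinarith
        have : 1 ≤ (D ^ 2)⁻¹ * centeredForm ρ c z ^ 2 := by
          rw [← inv_mul_cancel₀ (show D ^ 2 ≠ 0 by positivity)]
          gcongr
        linarith
    rw [biasedExp_sub, biasedExp_const, biasedExp_const_mul, hY] at hm
    have : (D ^ 2)⁻¹ * (4 * ρ * (1 - ρ)) ≤ 1 / 20 := by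
      rw [inv_mul_le_iff₀ (by positivity)]
      nlinarith
    linarith
  set P := prob (fun x => t + 36 / R < linForm a x) with hP
  have hPN : 19 / 20 * P ≤ expectation (fun x => f x * noise ρ f x) := by
    rw [hP, prob, ← expectation_const_mul]
    refine expectation_mono fun x => ?_
    have hn0 : 0 ≤ f x * noise ρ f x := mul_nonneg (by rcases hf01 x with h | h <;> simp [h])
      (biasedExp_nonneg hρ0.le (by linarith) fun z => by
        rcases hf01 (x * z) with h | h <;> simp [h])
    split_ifs with hx
    · have hfx : f x = 1 := by
        have : t < linForm a x := lt_trans (lt_add_of_pos_right _ (by positivity)) hx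
        simp [hf, halfspace, this]
      rw [hfx, one_mul, mul_one]
      exact hnoise x hx
    · simpa using hn0
  have hP0 : 0 ≤ P := prob_nonneg _
  by_contra hcon
  push Not at hcon
  nlinarith [pow_le_pow_left₀ (by positivity) hPN 2]

/-- Noise preserves the uniform measure. -/
theorem expectation_noise (ρ : ℝ) {n : ℕ} (f : Cube n → ℝ) :
    expectation (noise ρ f) = expectation f := by
  have h : noise ρ f = fun x => ∑ z, (∏ i, if z i = 1 then 1 - ρ else ρ) * f (x * z) := rfl
  rw [h, expectation_sum]
  simp only [expectation_const_mul, expectation_mul_right]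
  exact biasedExp_const ρ (n := n) (expectation f)

/-- A polynomial minorant of an indicator function, with positive mean for every centred variable of
variance `1` and fourth moment at most `4`. -/
theorem quartic_le_indicator (w : ℝ) :
    9 * w + 8 * w ^ 2 - w ^ 4 - 3 ≤ 33 * (if 1 / 4 < w then 1 else 0) := by
  split_ifs with h
  · nlinarith [sq_nonneg (w ^ 2 - 5), sq_nonneg (4 * w - 9)]
  · push Not at h
    rcases le_total 0 w with h0 | h0
    · nlinarith [pow_nonneg h0 4]
    · nlinarith [mul_nonneg (neg_nonneg.2 h0) (mul_nonneg (sq_nonneg (-w - 1633 / 1000))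
        (show 0 ≤ -w + 3266 / 1000 by linarith))]

/-- One-sided anti-concentration: a centred biased linear form of variance `σ ^ 2` without dominant
coefficients exceeds `σ / 4` with probability at least `1 / 33`. -/
theorem one_le_mul_biasedExp_lt_centeredForm {ρ : ℝ} (h0 : 0 < ρ) (h1 : ρ < 1) {n : ℕ}
    (c : Fin n → ℝ) (hc : ∑ i, c i ^ 2 = 1) {σ : ℝ} (hσ : 0 < σ) (hσ2 : σ ^ 2 = 4 * ρ * (1 - ρ))
    (hc4 : ∀ i, 4 * c i ^ 2 ≤ σ ^ 2) :
    1 ≤ 33 * biasedExp ρ (fun z => if σ / 4 < centeredForm ρ c z then 1 else 0) := by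
  have m1 := biasedExp_centeredForm ρ c
  have m2 := biasedExp_centeredForm_sq ρ c
  have m4 := biasedExp_centeredForm_pow_four_le h0.le h1.le c
  rw [hc, ← hσ2] at m2 m4
  have hs4 : 4 * ∑ i, c i ^ 4 ≤ σ ^ 2 := by
    rw [mul_sum, ← mul_one (σ ^ 2), ← hc, mul_sum]
    refine sum_le_sum fun i _ => ?_
    nlinarith [hc4 i, sq_nonneg (c i)]
  have hle : biasedExp ρ (fun z => 9 * σ ^ 3 * centeredForm ρ c z +
      8 * σ ^ 2 * centeredForm ρ c z ^ 2 - centeredForm ρ c z ^ 4 - 3 * σ ^ 4) ≤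
      biasedExp ρ (fun z => 33 * σ ^ 4 * (if σ / 4 < centeredForm ρ c z then 1 else 0)) := by
    refine biasedExp_mono h0.le h1.le fun z => ?_
    set Y := centeredForm ρ c z
    have h := quartic_le_indicator (Y / σ)
    have e : (1 / 4 < Y / σ) = (σ / 4 < Y) := by
      rw [lt_div_iff₀ hσ]; congr 1; ring
    simp only [e] at h
    have h' := mul_le_mul_of_nonneg_left h (show 0 ≤ σ ^ 4 by positivity)
    have e2 : σ ^ 4 * (9 * (Y / σ) + 8 * (Y / σ) ^ 2 - (Y / σ) ^ 4 - 3) =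
        9 * σ ^ 3 * Y + 8 * σ ^ 2 * Y ^ 2 - Y ^ 4 - 3 * σ ^ 4 := by
      field_simp
    rw [e2] at h'
    linarith
  rw [biasedExp_sub, biasedExp_sub, biasedExp_add, biasedExp_const_mul, biasedExp_const_mul,
    biasedExp_const_mul ρ (33 * σ ^ 4), biasedExp_const, m1, m2] at hle
  have hp : 0 < σ ^ 4 := by positivity
  have : σ ^ 4 * 1 ≤ σ ^ 4 * (33 * biasedExp ρ
      (fun z => if σ / 4 < centeredForm ρ c z then 1 else 0)) := by nlinarith [sq_nonneg σ]
  exact le_of_mul_le_mul_left this hp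

/-- Reverse local Chernoff inequality: if all weights are small compared with
`1 / √(log (1 / ε))`, lowering the threshold by a small multiple of that quantity increases the
measure `ε` of the halfspace by a bounded factor only. -/
theorem prob_sub_shift_le {n : ℕ} (a : Fin n → ℝ) (ha : ∑ i, a i ^ 2 = 1) {t : ℝ} (ht : 0 ≤ t)
    (h0 : 0 < prob (fun x => t < linForm a x)) (h1 : prob (fun x => t < linForm a x) ≤ 1 / 2)
    (hmax : ∀ i, |a i| * √(Real.log (1 / prob (fun x => t < linForm a x))) ≤ 1 / 1024) :
    prob (fun x => t - 1 / (256 * √(Real.log (1 / prob (fun x => t < linForm a x)))) < linForm a x) ≤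
      33 * prob (fun x => t < linForm a x) := by
  classical
  set ε := prob (fun x => t < linForm a x) with hε
  have htL := threshold_le_sqrt a ha ht h0
  rw [← hε] at htL
  have hL2 : Real.log 2 ≤ Real.log (1 / ε) :=
    Real.log_le_log (by norm_num) (by rw [le_div_iff₀ h0]; linarith)
  have hl2 := Real.log_two_gt_d9
  set L := Real.log (1 / ε) with hL
  have hLpos : 0 < L := by linarith
  set R := √L with hR
  have hRpos : 0 < R := Real.sqrt_pos.2 hLpos
  have hR2 : R ^ 2 = L := Real.sq_sqrt hLpos.le
  set ρ : ℝ := 1 / (1024 * L) with hρ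
  have hρ0 : 0 < ρ := by positivity
  have hρ1 : ρ ≤ 1 / 2 := by
    rw [hρ, div_le_div_iff₀ (by positivity) (by norm_num)]; linarith
  set σ := √(4 * ρ * (1 - ρ)) with hσ
  have hvpos : 0 < 4 * ρ * (1 - ρ) := by
    have : 0 < 1 - ρ := by linarith
    positivity
  have hσpos : 0 < σ := Real.sqrt_pos.2 hvpos
  have hσ2 : σ ^ 2 = 4 * ρ * (1 - ρ) := Real.sq_sqrt hvpos.le
  have hσ2' : 2 * ρ ≤ σ ^ 2 := by rw [hσ2]; nlinarith
  have hρR : ρ = (1 / R) ^ 2 / 1024 := by rw [hρ, ← hR2]; field_simp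
  set y := 1 / R with hy
  have hy0 : 0 < y := by positivity
  have hyR : y * R = 1 := by rw [hy]; field_simp
  have hσy : 11 / 256 * y ≤ σ := by
    refine le_of_sq_le_sq ?_ hσpos.le
    nlinarith
  -- The deviation `σ / 4` outweighs both the shift of the threshold and the drift `2 * ρ * t`.
  have hfin : y / 256 + 2 * ρ * t ≤ σ / 4 := by
    have : ρ * t ≤ y * (3 / 2) / 1024 := by
      calc ρ * t ≤ ρ * (3 / 2 * R) := mul_le_mul_of_nonneg_left htL hρ0.le
        _ = y * (y * R) * (3 / 2) / 1024 := by rw [hρR]; ring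
        _ = _ := by rw [hyR]; ring
    linarith
  set f : Cube n → ℝ := halfspace a t with hf
  have hs : 1 / (256 * R) = y / 256 := by rw [hy]; field_simp
  rw [hs]
  have key : ∀ x, t - y / 256 < linForm a x → 1 ≤ 33 * noise ρ f x := by
    intro x hx
    set c : Fin n → ℝ := fun i => a i * ((x i : ℤ) : ℝ) with hc
    have hc2 : ∑ i, c i ^ 2 = 1 := by simp only [hc, mul_pow, unit_sq, mul_one, ha]
    have hc4 : ∀ i, 4 * c i ^ 2 ≤ σ ^ 2 := by
      intro i
      have e1 : c i ^ 2 = |a i| ^ 2 := by simp only [hc, mul_pow, unit_sq, mul_one, sq_abs]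
      have e2 : |a i| ≤ y / 1024 := by
        have := hmax i
        rw [hy, div_div, le_div_iff₀ (by positivity)]
        linarith
      have e3 := pow_le_pow_left₀ (abs_nonneg _) e2 2
      rw [e1]
      nlinarith
    refine (one_le_mul_biasedExp_lt_centeredForm hρ0 (by linarith) c hc2 hσpos hσ2 hc4).trans ?_
    gcongr
    refine biasedExp_mono hρ0.le (by linarith) fun z => ?_
    rw [hf, halfspace, linForm_mul ρ]
    change _ ≤ if t < centeredForm ρ c z + (1 - 2 * ρ) * linForm a x then (1 : ℝ) else 0
    by_cases hz : σ / 4 < centeredForm ρ c z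
    · have : t < centeredForm ρ c z + (1 - 2 * ρ) * linForm a x := by
        have : (1 - 2 * ρ) * (t - y / 256) ≤ (1 - 2 * ρ) * linForm a x :=
          mul_le_mul_of_nonneg_left hx.le (by linarith)
        nlinarith
      rw [if_pos this, if_pos hz]
    · simp only [hz, if_false]
      split_ifs <;> norm_num
  have hεf : ε = expectation (noise ρ f) := (expectation_noise ρ f).symm
  rw [hεf, ← expectation_const_mul, prob]
  refine expectation_mono fun x => ?_
  split_ifs with hx
  · exact key x hx
  · exact mul_nonneg (by norm_num) (biasedExp_nonneg hρ0.le (by linarith) fun z => by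
      simp only [hf, halfspace]; split_ifs <;> norm_num)

/-! ### A Littlewood–Offord bound -/

theorem expectation_cos_linForm {n : ℕ} (a : Fin n → ℝ) (c l : ℝ) :
    expectation (fun x => Real.cos (c + l * linForm a x)) =
      Real.cos c * ∏ i, Real.cos (l * a i) := by
  induction n generalizing c with
  | zero => rw [expectation_eq_biasedExp, biasedExp_zero]; simp [linForm]
  | succ n ih =>
    have h : ∀ (b : ℤˣ), expectation (fun z : Cube n =>
        Real.cos (c + l * linForm a (Fin.cons b z))) =
        Real.cos (c + l * a 0 * ((b : ℤ) : ℝ)) * ∏ i : Fin n, Real.cos (l * a i.succ) := by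
      intro b
      rw [← ih]
      congr 1
      ext z
      rw [linForm_cons]
      ring_nf
    rw [expectation_succ, h, h, Fin.prod_univ_succ]
    push_cast
    rw [mul_one, mul_neg_one, ← sub_eq_add_neg, Real.cos_add, Real.cos_sub]
    ring

theorem fejer_eq (θ : ℝ) (K : ℕ) :
    ∑ k ∈ range K, ∑ l ∈ range K, Real.cos (((k : ℝ) - l) * θ) =
      (∑ k ∈ range K, Real.cos (k * θ)) ^ 2 + (∑ k ∈ range K, Real.sin (k * θ)) ^ 2 := by
  simp only [sq, sum_mul_sum, ← sum_add_distrib, sub_mul, Real.cos_sub]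

theorem summable_pow_natAbs {q : ℝ} (h0 : 0 ≤ q) (h1 : q < 1) :
    Summable (fun d : ℤ => q ^ d.natAbs) := by
  apply Summable.of_nat_of_neg <;> simpa using summable_geometric_of_lt_one h0 h1

/-- A Littlewood–Offord bound: an interval of twice the length of the largest weight `m` has
probability `O(m)`. The Fejér kernel of order `K ≈ 1 / (2m)` is nonnegative and is at least
`K ^ 2 / 2` on the interval, while its mean is `O(K)`, since `E cos (d S) = ∏ i, cos (d a i)` decays
like a Gaussian for `|d| ≤ K`. -/
theorem exists_prob_interval_le :
    ∃ C : ℝ, 0 < C ∧ ∀ (n : ℕ) (a : Fin n → ℝ) (m t : ℝ), 0 < m → m ≤ 1 / 2 → (∀ i, 0 ≤ a i) →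
      (∀ i, a i ≤ m) → ∑ i, a i ^ 2 = 1 →
      prob (fun x => t < linForm a x ∧ linForm a x ≤ t + 2 * m) ≤ C * m := by
  classical
  set q := Real.exp (-1 / 5) with hq
  have hsum := summable_pow_natAbs (Real.exp_pos (-1 / 5)).le
    (Real.exp_lt_one_iff.2 (by norm_num : (-1 / 5 : ℝ) < 0))
  rw [← hq] at hsum
  have hq0 : ∀ d : ℤ, 0 ≤ q ^ d.natAbs := fun d => pow_nonneg (Real.exp_pos _).le _
  set C := ∑' d : ℤ, q ^ d.natAbs with hC
  have hCpos : 0 < C := hsum.tsum_pos hq0 0 (by simp)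
  refine ⟨8 * C, by positivity, fun n a m t hm hm2 ha0 ham ha => ?_⟩
  obtain ⟨K, hK1, hK2⟩ : ∃ K : ℕ, K * m ≤ 1 / 2 ∧ 1 ≤ 4 * (K * m) := by
    refine ⟨⌊1 / (2 * m)⌋₊, ?_, ?_⟩
    · have := Nat.floor_le (show 0 ≤ 1 / (2 * m) by positivity)
      rw [le_div_iff₀ (by positivity)] at this
      linarith
    · have h1 := Nat.lt_floor_add_one (1 / (2 * m))
      have h2 : 1 ≤ 1 / (2 * m) := by rw [le_div_iff₀ (by positivity)]; linarith
      have h3 : (1 : ℝ) ≤ ⌊1 / (2 * m)⌋₊ := by exact_mod_cast Nat.le_floor (by simpa using h2)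
      rw [div_lt_iff₀ (by positivity)] at h1
      nlinarith
  have hKpos : (0 : ℝ) < K := by
    by_contra h
    have : (K : ℝ) * m ≤ 0 := mul_nonpos_of_nonpos_of_nonneg (not_lt.1 h) hm.le
    linarith
  set P := prob (fun x => t < linForm a x ∧ linForm a x ≤ t + 2 * m) with hP
  have hlow : (K : ℝ) ^ 2 / 2 * P ≤ expectation (fun x => ∑ k ∈ range K, ∑ l ∈ range K,
      Real.cos (((k : ℝ) - l) * (linForm a x - (t + m)))) := by
    rw [hP, prob, ← expectation_const_mul]
    refine expectation_mono fun x => ?_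
    rw [fejer_eq]
    split_ifs with hx
    · have hc : (K : ℝ) * (7 / 8) ≤
          ∑ k ∈ range K, Real.cos (k * (linForm a x - (t + m))) := by
        have : ∑ k ∈ range K, (7 / 8 : ℝ) = K * (7 / 8) := by simp
        rw [← this]
        refine sum_le_sum fun k hk => ?_
        have hkK : (k : ℝ) ≤ K := by exact_mod_cast (mem_range.1 hk).le
        have h1 : |linForm a x - (t + m)| ≤ m := abs_le.2 ⟨by linarith [hx.1], by linarith [hx.2]⟩
        have h2 : |(k : ℝ) * (linForm a x - (t + m))| ≤ 1 / 2 := by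
          rw [abs_mul, Nat.abs_cast]
          exact (mul_le_mul hkK h1 (abs_nonneg _) hKpos.le).trans hK1
        have h3 := Real.one_sub_sq_div_two_le_cos (x := (k : ℝ) * (linForm a x - (t + m)))
        have h4 := sq_le_sq' (neg_le_of_abs_le h2) (le_of_abs_le h2)
        linarith
      have := pow_le_pow_left₀ (by positivity) hc 2
      nlinarith [sq_nonneg (∑ k ∈ range K, Real.sin (k * (linForm a x - (t + m)))), sq_nonneg (K : ℝ)]
    · rw [mul_zero]; positivity
  have hcos : ∀ d : ℤ, d.natAbs ≤ K → expectation (fun x =>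
      Real.cos ((d : ℝ) * (linForm a x - (t + m)))) ≤ q ^ d.natAbs := by
    intro d hd
    have habs : |(d : ℝ)| = d.natAbs := by rw [Nat.cast_natAbs, Int.cast_abs]
    have e1 : (fun x => Real.cos ((d : ℝ) * (linForm a x - (t + m)))) =
        fun x => Real.cos (-(d * (t + m)) + d * linForm a x) := by ext x; ring_nf
    rw [e1, expectation_cos_linForm]
    have hfac : ∀ i, 0 ≤ Real.cos (d * a i) ∧
        Real.cos (d * a i) ≤ Real.exp (-(d : ℝ) ^ 2 / 5 * a i ^ 2) := by
      intro i
      have h1 : |(d : ℝ) * a i| ≤ 1 / 2 := by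
        rw [abs_mul, habs, abs_of_nonneg (ha0 i)]
        exact (mul_le_mul (by exact_mod_cast hd) (ham i) (ha0 i) hKpos.le).trans hK1
      have hpi := Real.pi_gt_three
      have hpi' := Real.pi_lt_d2
      constructor
      · exact Real.cos_nonneg_of_neg_pi_div_two_le_of_le (by linarith [neg_le_of_abs_le h1])
          (by linarith [le_of_abs_le h1])
      · have h2 := Real.cos_le_one_sub_mul_cos_sq (x := d * a i) (by linarith)
        have h3 : 1 / 5 ≤ 2 / Real.pi ^ 2 := by
          rw [div_le_div_iff₀ (by norm_num) (by positivity)]; nlinarith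
        have h4 := Real.add_one_le_exp (-(d : ℝ) ^ 2 / 5 * a i ^ 2)
        nlinarith [sq_nonneg ((d : ℝ) * a i)]
    have hprod : ∏ i, Real.cos (d * a i) ≤ q ^ d.natAbs := by
      calc _ ≤ ∏ i, Real.exp (-(d : ℝ) ^ 2 / 5 * a i ^ 2) :=
            prod_le_prod (fun i _ => (hfac i).1) fun i _ => (hfac i).2
        _ = Real.exp (-(d : ℝ) ^ 2 / 5) := by rw [← Real.exp_sum, ← mul_sum, ha, mul_one]
        _ ≤ Real.exp (d.natAbs * (-1 / 5)) := by
            apply Real.exp_le_exp.2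
            have h5 : (d.natAbs : ℝ) ≤ (d : ℝ) ^ 2 := by
              have : d.natAbs ≤ d.natAbs ^ 2 := Nat.le_self_pow (by norm_num) _
              have h6 : (d.natAbs : ℝ) ≤ (d.natAbs : ℝ) ^ 2 := by exact_mod_cast this
              rwa [← habs, sq_abs, habs] at h6
            linarith
        _ = _ := Real.exp_nat_mul _ _
    have hprod0 : 0 ≤ ∏ i, Real.cos (d * a i) := prod_nonneg fun i _ => (hfac i).1
    nlinarith [Real.cos_le_one (-((d : ℝ) * (t + m)))]
  have hup : expectation (fun x => ∑ k ∈ range K, ∑ l ∈ range K,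
      Real.cos (((k : ℝ) - l) * (linForm a x - (t + m)))) ≤ K * C := by
    simp only [expectation_sum]
    have : ∑ k ∈ range K, C = K * C := by simp
    rw [← this]
    refine sum_le_sum fun k hk => ?_
    have hinj : Set.InjOn (fun l : ℕ => (k : ℤ) - l) (range K) := fun x _ y _ h => by
      simp only at h; omega
    calc _ ≤ ∑ l ∈ range K, q ^ ((k : ℤ) - l).natAbs := by
          refine sum_le_sum fun l hl => ?_
          have h1 := hcos ((k : ℤ) - l) (by have := mem_range.1 hk; have := mem_range.1 hl; omega)
          push_cast at h1
          exact h1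
      _ = ∑ d ∈ (range K).image (fun l : ℕ => (k : ℤ) - l), q ^ d.natAbs :=
          (sum_image (f := fun d : ℤ => q ^ d.natAbs) hinj).symm
      _ ≤ C := hsum.sum_le_tsum _ fun d _ => hq0 d
  have h1 : (K : ℝ) * P ≤ 2 * C := by
    have : (K : ℝ) * (K * P) ≤ K * (2 * C) := by nlinarith
    exact le_of_mul_le_mul_left this hKpos
  have hP0 : 0 ≤ P := prob_nonneg _
  calc P = 1 * P := (one_mul P).symm
    _ ≤ 4 * (K * m) * P := mul_le_mul_of_nonneg_right hK2 hP0
    _ = 4 * m * (K * P) := by ring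
    _ ≤ 4 * m * (2 * C) := by gcongr
    _ = _ := by ring

/-! ### The probability of the layer above the threshold -/

theorem prob_long_interval_le {n : ℕ} (hn : 0 < n) (a : Fin n → ℝ) (ha : Antitone a)
    (ha0 : ∀ i, 0 ≤ a i) {t : ℝ} (ht : 0 ≤ t) (J : ℕ) :
    prob (fun x => t < linForm a x ∧ linForm a x ≤ t + J * (2 * a ⟨0, hn⟩)) ≤
      J * (8 * prob (fun x => x ⟨0, hn⟩ = 1 ∧ t < linForm a x ∧
        linForm a x ≤ t + 2 * a ⟨0, hn⟩)) := by
  induction J with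
  | zero =>
    refine (prob_mono (B := fun _ => False) fun x hx => ?_).trans ?_
    · have := hx.2
      push_cast at this
      linarith [hx.1]
    · simp [prob, expectation_const]
  | succ J ih =>
    have h1 := prob_interval_le_influence hn a ha ha0 ht
      (u := t + J * (2 * a ⟨0, hn⟩)) (by have := ha0 ⟨0, hn⟩; nlinarith [Nat.cast_nonneg (α := ℝ) J])
    have h2 := prob_le_add (n := n)
      (A := fun x => t < linForm a x ∧ linForm a x ≤ t + (J + 1 : ℕ) * (2 * a ⟨0, hn⟩))
      (B := fun x => t < linForm a x ∧ linForm a x ≤ t + J * (2 * a ⟨0, hn⟩))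
      (C := fun x => t + J * (2 * a ⟨0, hn⟩) < linForm a x ∧
        linForm a x ≤ t + J * (2 * a ⟨0, hn⟩) + 2 * a ⟨0, hn⟩) (by
        intro x hx
        have h3 := hx.2
        push_cast at h3
        by_cases hc : linForm a x ≤ t + J * (2 * a ⟨0, hn⟩)
        · exact Or.inl ⟨hx.1, hc⟩
        · exact Or.inr ⟨not_le.1 hc, by linarith⟩)
    push_cast at h2 ⊢
    linarith

/-- The reflection principle places `J` disjoint copies of the interval `(t, t + 2m]`, each enlarged
to length `4m`, side by side below `t`. -/
theorem mul_prob_interval_le {n : ℕ} (a : Fin n → ℝ) {m : ℝ} (hm : 0 ≤ m) (ha0 : ∀ i, 0 ≤ a i)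
    (ham : ∀ i, a i ≤ m) {t : ℝ} (J : ℕ) (hJ : J * (4 * m) ≤ t) :
    J * prob (fun x => t < linForm a x ∧ linForm a x ≤ t + 2 * m) ≤
      prob (fun x => t - J * (4 * m) < linForm a x ∧ linForm a x ≤ t) := by
  induction J with
  | zero => simpa using prob_nonneg _
  | succ J ih =>
    push_cast at hJ ⊢
    have hJm : 0 ≤ J * m := by positivity
    have h1 := ih (by linarith)
    have h2 := prob_interval_le_reflect a m ha0 ham (2 * m * J + m) t (t + 2 * m) (by nlinarith)
      (Or.inr (by nlinarith))
    have h3 := prob_add_le (n := n)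
      (A := fun x => t - (J + 1) * (4 * m) < linForm a x ∧ linForm a x ≤ t)
      (B := fun x => t - 2 * (2 * m * J + m) - 2 * m < linForm a x ∧
        linForm a x ≤ t + 2 * m - 2 * (2 * m * J + m))
      (C := fun x => t - J * (4 * m) < linForm a x ∧ linForm a x ≤ t)
      (fun x hx => ⟨by linarith [hx.1], by linarith [hx.2]⟩)
      (fun x hx => ⟨by linarith [hx.1], by linarith [hx.2]⟩)
      (fun x hx hx' => by linarith [hx.2, hx'.1])
    linarith

theorem mul_min_le_influence {n : ℕ} (hn : 0 < n) (a : Fin n → ℝ) (ha : Antitone a)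
    (ha0 : ∀ i, 0 ≤ a i) (hpos : 0 < a ⟨0, hn⟩) (hsq : ∑ i, a i ^ 2 = 1) {t : ℝ} (ht : 0 ≤ t)
    (h0 : 0 < prob (fun x => t < linForm a x)) (h1 : prob (fun x => t < linForm a x) ≤ 1 / 2) :
    prob (fun x => t < linForm a x) *
        min 1 (a ⟨0, hn⟩ * √(Real.log (1 / prob (fun x => t < linForm a x)))) ≤
      608 * prob (fun x => x ⟨0, hn⟩ = 1 ∧ t < linForm a x ∧ linForm a x ≤ t + 2 * a ⟨0, hn⟩) := by
  have hc := prob_add_shift_le a hsq ht h0 h1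
  set ε := prob (fun x => t < linForm a x) with hε
  set Q := prob (fun x => x ⟨0, hn⟩ = 1 ∧ t < linForm a x ∧ linForm a x ≤ t + 2 * a ⟨0, hn⟩) with hQ
  have hQ0 : 0 ≤ Q := prob_nonneg _
  set R := √(Real.log (1 / ε)) with hR
  have hRpos : 0 < R := Real.sqrt_pos.2 (Real.log_pos (by rw [lt_div_iff₀ h0]; linarith))
  set m := a ⟨0, hn⟩ with hm
  set J := ⌈36 / R / (2 * m)⌉₊ with hJ
  have hJ1 : 36 / R ≤ J * (2 * m) := by
    rw [← div_le_iff₀ (by positivity)]; exact Nat.le_ceil _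
  have hJ2 : (J : ℝ) < 36 / R / (2 * m) + 1 := Nat.ceil_lt_add_one (by positivity)
  have h2 := prob_long_interval_le hn a ha ha0 ht J
  rw [← hm, ← hQ] at h2
  have h3 := prob_le_add (n := n) (A := fun x => t < linForm a x)
    (B := fun x => t + 36 / R < linForm a x)
    (C := fun x => t < linForm a x ∧ linForm a x ≤ t + J * (2 * m)) (by
      intro x hx
      by_cases hc : t + 36 / R < linForm a x
      · exact Or.inl hc
      · exact Or.inr ⟨hx, by linarith⟩)
  rw [← hε] at h3
  set M := min 1 (m * R) with hM
  have hmR : 0 < m * R := by positivity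
  have hM0 : 0 < M := lt_min one_pos hmR
  have hMJ : M * J ≤ 19 := by
    calc M * J ≤ M * (36 / R / (2 * m) + 1) := by gcongr
      _ = M * (18 / (m * R)) + M := by field_simp; ring
      _ ≤ m * R * (18 / (m * R)) + 1 := by
          gcongr
          · exact min_le_right _ _
          · exact min_le_left _ _
      _ = 19 := by field_simp; norm_num
  have h4 : ε ≤ 32 * J * Q := by linarith
  calc ε * M ≤ 32 * J * Q * M := by gcongr
    _ = 32 * Q * (M * J) := by ring
    _ ≤ 32 * Q * 19 := by gcongr
    _ = _ := by ring

/-- The layer of width `2m` above the threshold `t` has probability `O(ε min(1, m √(log (1 / ε))))`,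
where `ε` is the measure of the halfspace. -/
theorem exists_prob_interval_le_mul_min :
    ∃ C : ℝ, 0 < C ∧ ∀ (n : ℕ) (a : Fin n → ℝ) (m t : ℝ), 0 < m → (∀ i, 0 ≤ a i) →
      (∀ i, a i ≤ m) → ∑ i, a i ^ 2 = 1 → 0 ≤ t → 0 < prob (fun x => t < linForm a x) →
      prob (fun x => t < linForm a x) ≤ 1 / 2 →
      prob (fun x => t < linForm a x ∧ linForm a x ≤ t + 2 * m) ≤
        C * (prob (fun x => t < linForm a x) *
          min 1 (m * √(Real.log (1 / prob (fun x => t < linForm a x))))) := by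
  obtain ⟨C, hC, hLO⟩ := exists_prob_interval_le
  refine ⟨33 * 2048 + 132 * C, by positivity, fun n a m t hm ha0 ham hsq ht h0 h1 => ?_⟩
  have hrev := prob_sub_shift_le a hsq ht h0 h1
  set ε := prob (fun x => t < linForm a x) with hε
  have hL2 : Real.log 2 ≤ Real.log (1 / ε) :=
    Real.log_le_log (by norm_num) (by rw [le_div_iff₀ h0]; linarith)
  have hl2 := Real.log_two_gt_d9
  set R := √(Real.log (1 / ε)) with hR
  have hR2 : 1 / 2 ≤ R := Real.le_sqrt_of_sq_le (by linarith)
  have hRpos : 0 < R := by linarith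
  set P := prob (fun x => t < linForm a x ∧ linForm a x ≤ t + 2 * m) with hP
  have hPε : P ≤ ε := prob_mono fun x hx => hx.1
  have hmR : 0 < m * R := by positivity
  -- If `m * R` is not small, the trivial bound `P ≤ ε` suffices.
  rcases lt_or_ge (1 / 1024) (m * R) with hy | hy
  · have hmin : 1 / 1024 ≤ min 1 (m * R) := le_min (by norm_num) hy.le
    calc P ≤ 1024 * (ε * (1 / 1024)) := by linarith
      _ ≤ (33 * 2048 + 132 * C) * (ε * min 1 (m * R)) := by gcongr; linarith
  · rw [min_eq_right (by linarith)]
    have hrev := hrev fun i => by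
      rw [abs_of_nonneg (ha0 i)]
      exact (mul_le_mul_of_nonneg_right (ham i) hRpos.le).trans hy
    set s := 1 / (256 * R) with hs
    have hspos : 0 < s := by positivity
    have hsm : 4 * m ≤ s := by rw [hs, le_div_iff₀ (by positivity)]; linarith
    rcases le_or_gt s t with hst | hst
    · set J := ⌊s / (4 * m)⌋₊ with hJ
      have hJ1 : J * (4 * m) ≤ s := by
        rw [← le_div_iff₀ (by positivity)]; exact Nat.floor_le (by positivity)
      have hJ2 : s / (4 * m) < J + 1 := Nat.lt_floor_add_one _
      have hJ3 : (1 : ℝ) ≤ J := by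
        exact_mod_cast Nat.le_floor (by rw [Nat.cast_one, le_div_iff₀ (by positivity)]; linarith)
      have h2 := mul_prob_interval_le a hm.le ha0 ham J (hJ1.trans hst)
      have h3 : J * P ≤ 33 * ε :=
        h2.trans ((prob_mono fun x hx => by linarith [hx.1]).trans hrev)
      have hJ4 : 1 ≤ 2048 * (m * R) * J := by
        rw [div_lt_iff₀ (by positivity), hs, div_lt_iff₀ (by positivity)] at hJ2
        nlinarith
      have hP0 : 0 ≤ P := prob_nonneg _
      calc P ≤ 2048 * (m * R) * J * P := le_mul_of_one_le_left hP0 hJ4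
        _ = 2048 * (m * R) * (J * P) := by ring
        _ ≤ 2048 * (m * R) * (33 * ε) := by gcongr
        _ = 33 * 2048 * (ε * (m * R)) := by ring
        _ ≤ _ := by gcongr; linarith
    -- Near the origin the measure of the halfspace is bounded below.
    · have h2 : 1 / 2 ≤ 33 * ε := (half_le_prob_nonneg a).trans
        ((prob_mono fun x hx => by linarith).trans hrev)
      have hm2 : m ≤ 2 * (m * R) := by nlinarith
      calc P ≤ C * m := hLO n a m t hm (by linarith) ha0 ham hsq
        _ ≤ C * (2 * (m * R)) * (2 * (33 * ε)) := by
          refine (mul_le_mul_of_nonneg_left hm2 hC.le).trans (le_mul_of_one_le_right ?_ ?_)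
          · positivity
          · linarith
        _ = 132 * C * (ε * (m * R)) := by ring
        _ ≤ _ := by gcongr; linarith

/-! ### The vertex boundary of a halfspace -/

theorem prob_eq_self_pos {n : ℕ} (y : Cube n) : 0 < prob (fun x => x = y) := by
  have := prob_eq_card ({y} : Finset (Cube n))
  simp only [mem_singleton] at this
  rw [← this]
  simp

/-- A halfspace with negative threshold and its image under `x ↦ -x` cover the cube. If it has
measure at most `1/2`, they are therefore disjoint, and no point of it has `linForm a x ≤ 0`. -/
theorem halfspace_eq_zero_threshold {n : ℕ} (a : Fin n → ℝ) {t : ℝ} (ht : t < 0)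
    (h : expectation (halfspace a t) ≤ 1 / 2) : halfspace a t = halfspace a 0 := by
  classical
  have key : ∀ y, t < linForm a y → 0 < linForm a y := by
    intro y hy
    by_contra hy0
    have h1 := prob_neg (fun x => t < linForm a x)
    simp only [linForm_neg] at h1
    rw [expectation_halfspace] at h
    have h2 : expectation (fun x : Cube n => 1 + if x = y then (1 : ℝ) else 0) ≤
        prob (fun x => t < linForm a x) + prob (fun x => t < - linForm a x) := by
      rw [prob, prob, ← expectation_add]
      refine expectation_mono fun x => ?_
      by_cases hx : x = y
      · have h3 : t < - linForm a y := by linarith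
        simp [hx, hy, h3]
      · rcases le_total 0 (linForm a x) with h3 | h3
        · have h4 : t < linForm a x := by linarith
          simp only [hx, h4, if_true, if_false]
          split_ifs <;> norm_num
        · have h4 : t < - linForm a x := by linarith
          simp only [hx, h4, if_true, if_false]
          split_ifs <;> norm_num
    rw [expectation_add, expectation_const] at h2
    have h5 : 0 < expectation (fun x : Cube n => if x = y then (1 : ℝ) else 0) := by
      have h6 := prob_eq_self_pos y
      rw [prob] at h6
      convert h6
    linarith
  ext x
  by_cases hx : t < linForm a x
  · simp [halfspace, hx, key x hx]
  · have : ¬ 0 < linForm a x := by linarith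
    simp [halfspace, hx, this]

theorem influence_le_vertexBoundary {n : ℕ} (a : Fin n → ℝ) (t : ℝ) (i : Fin n) :
    prob (fun x => x i = 1 ∧ t < linForm a x ∧ linForm a x ≤ t + 2 * a i) ≤
      ((vertexBoundary (oneSet (halfspace a t))).card : ℝ) / 2 ^ n := by
  rw [prob_eq_card]
  refine prob_mono fun x hx => ?_
  simp only [vertexBoundary, mem_filter, mem_oneSet_halfspace, linForm_flipCoord]
  refine ⟨hx.2.1, i, ?_⟩
  rw [hx.1]
  push_cast
  linarith [hx.2.2]

theorem vertexBoundary_le_prob_interval {n : ℕ} (a : Fin n → ℝ) {m : ℝ} (ha0 : ∀ i, 0 ≤ a i)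
    (ham : ∀ i, a i ≤ m) (t : ℝ) :
    ((vertexBoundary (oneSet (halfspace a t))).card : ℝ) / 2 ^ n ≤
      prob (fun x => t < linForm a x ∧ linForm a x ≤ t + 2 * m) := by
  rw [prob_eq_card]
  refine prob_mono fun x hx => ?_
  simp only [vertexBoundary, mem_filter, mem_oneSet_halfspace, linForm_flipCoord] at hx
  obtain ⟨hx, i, hi⟩ := hx
  refine ⟨hx, ?_⟩
  have h1 := ham i
  have h2 := ha0 i
  rcases Int.units_eq_one_or (x i) with h | h <;> rw [h] at hi <;> push_cast at hi <;> linarith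

/-- The two-sided bound for nonnegative thresholds. -/
theorem exists_vertexBoundary_bounds :
    ∃ c₁ c₂ : ℝ, 0 < c₁ ∧ 0 < c₂ ∧
      ∀ (n : ℕ) (hn : 0 < n) (a : Fin n → ℝ) (t : ℝ), 0 ≤ t →
        Antitone a → (∀ i, 0 ≤ a i) → ∑ i, a i ^ 2 = 1 →
        expectation (halfspace a t) ≤ 1 / 2 →
        c₁ * (expectation (halfspace a t) *
              min 1 (a ⟨0, hn⟩ * √(Real.log (1 / expectation (halfspace a t)))))
            ≤ ((vertexBoundary (oneSet (halfspace a t))).card : ℝ) / 2 ^ n ∧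
          ((vertexBoundary (oneSet (halfspace a t))).card : ℝ) / 2 ^ n
            ≤ c₂ * (expectation (halfspace a t) *
              min 1 (a ⟨0, hn⟩ * √(Real.log (1 / expectation (halfspace a t))))) := by
  obtain ⟨C, hC, hup⟩ := exists_prob_interval_le_mul_min
  refine ⟨1 / 608, C, by norm_num, hC, fun n hn a t ht ha ha0 hsq hε => ?_⟩
  have ham : ∀ i, a i ≤ a ⟨0, hn⟩ := fun i => ha (by simp [Fin.le_def])
  have hpos : 0 < a ⟨0, hn⟩ := by
    rcases (ha0 ⟨0, hn⟩).lt_or_eq with h | h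
    · exact h
    · exfalso
      have : ∀ i, a i = 0 := fun i => le_antisymm ((ham i).trans h.symm.le) (ha0 i)
      simp [this] at hsq
  have hlow := influence_le_vertexBoundary a t ⟨0, hn⟩
  have hhigh := vertexBoundary_le_prob_interval a ha0 ham t
  rw [expectation_halfspace] at hε ⊢
  -- An empty halfspace has empty boundary, and both outer expressions vanish.
  rcases (prob_nonneg (fun x => t < linForm a x)).eq_or_lt with h0 | h0
  · have h1 : prob (fun x => t < linForm a x ∧ linForm a x ≤ t + 2 * a ⟨0, hn⟩) ≤
        prob (fun x => t < linForm a x) := prob_mono fun x hx => hx.1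
    rw [← h0] at h1 ⊢
    rw [zero_mul, mul_zero, mul_zero]
    exact ⟨by positivity, hhigh.trans h1⟩
  · refine ⟨?_, hhigh.trans (hup n a _ t hpos ha0 ham hsq ht h0 hε)⟩
    have := mul_min_le_influence hn a ha ha0 hpos hsq ht h0 hε
    linarith

end BiasedHalfspace

theorem theorem4 :
    ∃ c₁ c₂ : ℝ, 0 < c₁ ∧ 0 < c₂ ∧
      ∀ (n : ℕ) (hn : 0 < n) (a : Fin n → ℝ) (t : ℝ),
        Antitone a → (∀ i, 0 ≤ a i) → ∑ i, a i ^ 2 = 1 →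
        BiasedHalfspace.expectation (BiasedHalfspace.halfspace a t) ≤ 1 / 2 →
        c₁ * (BiasedHalfspace.expectation (BiasedHalfspace.halfspace a t) *
              min 1 (a ⟨0, hn⟩ *
                √(Real.log (1 / BiasedHalfspace.expectation (BiasedHalfspace.halfspace a t)))))
            ≤ ((BiasedHalfspace.vertexBoundary
                (BiasedHalfspace.oneSet (BiasedHalfspace.halfspace a t))).card : ℝ) / 2 ^ n ∧
          ((BiasedHalfspace.vertexBoundary
                (BiasedHalfspace.oneSet (BiasedHalfspace.halfspace a t))).card : ℝ) / 2 ^ n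
            ≤ c₂ * (BiasedHalfspace.expectation (BiasedHalfspace.halfspace a t) *
              min 1 (a ⟨0, hn⟩ *
                √(Real.log (1 / BiasedHalfspace.expectation (BiasedHalfspace.halfspace a t))))) := by
  obtain ⟨c₁, c₂, h₁, h₂, h⟩ := BiasedHalfspace.exists_vertexBoundary_bounds
  refine ⟨c₁, c₂, h₁, h₂, fun n hn a t ha ha0 hsq hε => ?_⟩
  rcases le_or_gt 0 t with ht | ht
  · exact h n hn a t ht ha ha0 hsq hε
  · have e := BiasedHalfspace.halfspace_eq_zero_threshold a ht hε
    rw [e] at hε ⊢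
    exact h n hn a 0 le_rfl ha ha0 hsq hε
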